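/- Let $r\ge 0$ be an integer and let $p,q\in\mathbb{C}^{\times}$ satisfy $|p|>1$, $|q|>1$ and be multiplicatively independent, i.e. for $n,m\in\mathbb{Z}$, $p^nq^m=1$ if and only if $n=m=0$ (for instance, multiplicatively independent positive integers). Let $\sigma f(z)=f(z/p)$ and $\tau f(z)=f(z/q)$ on $\mathbb{C}((z))$, and let $\Gamma=\langle\sigma,\tau\rangle$. A pair $(A,B)$ of matrices in $GL_r(\mathbb{C}((z)))$ is called consistent if $B(z/p)A(z)=A(z/q)B(z)$, and the gauge transformation by $C\in GL_r(\mathbb{C}((z)))$ takes $(A,B)$ to $(C(z/p)^{-1}A(z)C(z),\,C(z/q)^{-1}B(z)C(z))$. Let $H^1(\Gamma,GL_r(\mathbb{C}((z))))$ be the set of consistent pairs up to gauge equivalence, and let $H^1(\Gamma,GL_r(\mathbb{C}))$ be the set of commuting pairs $(A_0,B_0)$ of matrices in $GL_r(\mathbb{C})$ up to simultaneous conjugation. Call $A_0\in GL_r(\mathbb{C})$ $p$-restricted if every eigenvalue $c$ of $A_0$ satisfies $1\le|c|<|p|$, and let $H^1(\Gamma,GL_r(\mathbb{C}))^{p\text{-restricted}}$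 be the set of classes of commuting pairs $(A_0,B_0)$ with $A_0$ $p$-restricted. Then the natural map $H^1(\Gamma,GL_r(\mathbb{C}))\to H^1(\Gamma,GL_r(\mathbb{C}((z))))$, induced by the inclusion $\mathbb{C}\subset\mathbb{C}((z))$, restricts to a bijection $$H^1(\Gamma,GL_r(\mathbb{C}))^{p\text{-restricted}}\;\simeq\;H^1(\Gamma,GL_r(\mathbb{C}((z)))).$$ Equivalently, every consistent pair $(A,B)$ of matrices in $GL_r(\mathbb{C}((z)))$ can be reduced by a gauge transformation with some $C\in GL_r(\mathbb{C}((z)))$ to a commuting pair $(A_0,B_0)$ of matrices in $GL_r(\mathbb{C})$ with $A_0$ $p$-restricted, and such a pair $(A_0,B_0)$ is unique up to simultaneous conjugation in $GL_r(\mathbb{C})$. -/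

import Mathlib

/-- The substitution `f(z) ↦ f(z/p)` of the field `ℂ((z))`:
`∑ aₙ zⁿ ↦ ∑ aₙ p⁻ⁿ zⁿ`. -/
noncomputable def scaleFun (p : ℂˣ) (f : LaurentSeries ℂ) : LaurentSeries ℂ where
  coeff n := (p : ℂ) ^ (-n) * f.coeff n
  isPWO_support' := f.isPWO_support.mono (fun n hn h => hn (by simp [h]))

theorem scaleFun_coeff (p : ℂˣ) (f : LaurentSeries ℂ) (n : ℤ) :
    (scaleFun p f).coeff n = (p : ℂ) ^ (-n) * f.coeff n := rfl

theorem scaleFun_support (p : ℂˣ) (f : LaurentSeries ℂ) :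
    (scaleFun p f).support = f.support := by
  ext n
  simp [HahnSeries.mem_support, scaleFun_coeff, zpow_ne_zero]

/-- `f(z) ↦ f(z/p)` as a ring endomorphism of `ℂ((z))`. -/
noncomputable def scale (p : ℂˣ) : LaurentSeries ℂ →+* LaurentSeries ℂ where
  toFun := scaleFun p
  map_zero' := by
    ext n
    simp [scaleFun_coeff]
  map_one' := by
    ext n
    by_cases h : n = 0 <;> simp [scaleFun_coeff, HahnSeries.coeff_one, h]
  map_add' f g := by
    ext n
    simp [scaleFun_coeff, mul_add]
  map_mul' f g := by
    ext n
    rw [scaleFun_coeff, HahnSeries.coeff_mul, HahnSeries.coeff_mul, Finset.mul_sum]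
    refine Finset.sum_congr ?_ ?_
    · ext ij
      simp [scaleFun_support]
    · intro ij hij
      have h : ij.1 + ij.2 = n := (Finset.mem_antidiagonal.1 hij).2.2
      rw [scaleFun_coeff, scaleFun_coeff, ← h, neg_add, zpow_add₀ p.ne_zero]
      ring

/-- `p` and `q` are multiplicatively independent: `pⁿ qᵐ = 1` (with `n, m ∈ ℤ`) if and only if
`n = m = 0`. -/
def MultIndep (p q : ℂˣ) : Prop :=
  ∀ n m : ℤ, p ^ n * q ^ m = 1 ↔ n = 0 ∧ m = 0

section Cohomology

variable {R S : Type*} [CommRing R] [CommRing S]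

/-- Pairs `(A, B)` in `GL_r(R)` satisfying the consistency condition `σ(B) A = τ(A) B`, for two
endomorphisms `σ, τ` of `R`: the cocycles of `Γ = ⟨σ, τ⟩` with values in `GL_r(R)`. -/
@[ext]
structure ConsistentPair (r : ℕ) (σ τ : R →+* R) where
  A : GL (Fin r) R
  B : GL (Fin r) R
  consistent : Matrix.GeneralLinearGroup.map σ B * A = Matrix.GeneralLinearGroup.map τ A * B

/-- The gauge transformation by `C ∈ GL_r(R)` takes `x = (A, B)` to
`y = (σ(C)⁻¹ A C, τ(C)⁻¹ B C)`. -/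
def ConsistentPair.GaugeBy {r : ℕ} {σ τ : R →+* R} (C : GL (Fin r) R)
    (x y : ConsistentPair r σ τ) : Prop :=
  y.A = (Matrix.GeneralLinearGroup.map σ C)⁻¹ * x.A * C ∧
    y.B = (Matrix.GeneralLinearGroup.map τ C)⁻¹ * x.B * C

/-- Gauge equivalence of consistent pairs (the relation of being cohomologous). -/
def gaugeSetoid (r : ℕ) (σ τ : R →+* R) : Setoid (ConsistentPair r σ τ) where
  r x y := ∃ C : GL (Fin r) R, x.GaugeBy C y
  iseqv :=
    { refl := fun x => ⟨1, by simp [ConsistentPair.GaugeBy]⟩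
      symm := by
        rintro x y ⟨C, hA, hB⟩
        refine ⟨C⁻¹, ?_, ?_⟩
        · rw [hA, map_inv]; group
        · rw [hB, map_inv]; group
      trans := by
        rintro x y w ⟨C, hA, hB⟩ ⟨D, hA', hB'⟩
        refine ⟨C * D, ?_, ?_⟩
        · rw [hA', hA, map_mul]; group
        · rw [hB', hB, map_mul]; group }

/-- The cohomology set `H¹(Γ, GL_r(R))`, `Γ = ⟨σ, τ⟩`: consistent pairs up to gauge equivalence. -/
def H1 (r : ℕ) (σ τ : R →+* R) : Type _ := Quotient (gaugeSetoid r σ τ)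

/-- Extension of scalars of a consistent pair along an equivariant ring homomorphism. -/
def ConsistentPair.map {r : ℕ} {σ τ : R →+* R} {σ' τ' : S →+* S} (ι : R →+* S)
    (hσ : σ'.comp ι = ι.comp σ) (hτ : τ'.comp ι = ι.comp τ) (x : ConsistentPair r σ τ) :
    ConsistentPair r σ' τ' where
  A := Matrix.GeneralLinearGroup.map ι x.A
  B := Matrix.GeneralLinearGroup.map ι x.B
  consistent := by
    have h := congrArg (Matrix.GeneralLinearGroup.map ι) x.consistent
    simpa only [map_mul, ← MonoidHom.comp_apply, ← Matrix.GeneralLinearGroup.map_comp, hσ, hτ]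
      using h

/-- The map induced on `H¹` by an equivariant ring homomorphism. -/
def H1.map {r : ℕ} {σ τ : R →+* R} {σ' τ' : S →+* S} (ι : R →+* S)
    (hσ : σ'.comp ι = ι.comp σ) (hτ : τ'.comp ι = ι.comp τ) : H1 r σ τ → H1 r σ' τ' :=
  Quotient.map (sa := gaugeSetoid r σ τ) (sb := gaugeSetoid r σ' τ')
    (ConsistentPair.map ι hσ hτ) (by
      rintro x y ⟨C, hA, hB⟩
      have e (D : GL (Fin r) R) (f : R →+* R) (g : S →+* S) (h : g.comp ι = ι.comp f) :
          Matrix.GeneralLinearGroup.map g (Matrix.GeneralLinearGroup.map ι D) =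
            Matrix.GeneralLinearGroup.map ι (Matrix.GeneralLinearGroup.map f D) := by
        rw [← MonoidHom.comp_apply, ← Matrix.GeneralLinearGroup.map_comp, h,
          Matrix.GeneralLinearGroup.map_comp, MonoidHom.comp_apply]
      refine ⟨Matrix.GeneralLinearGroup.map ι C, ?_, ?_⟩
      · rw [e C σ σ' hσ]
        simp only [ConsistentPair.map, hA, map_mul, map_inv]
      · rw [e C τ τ' hτ]
        simp only [ConsistentPair.map, hB, map_mul, map_inv])

end Cohomology

/-- Constants are fixed by `f(z) ↦ f(z/p)`. -/
theorem scale_comp_C (p : ℂˣ) :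
    (scale p).comp (HahnSeries.C : ℂ →+* LaurentSeries ℂ) =
      (HahnSeries.C : ℂ →+* LaurentSeries ℂ).comp (RingHom.id ℂ) := by
  ext c n
  by_cases h : n = 0 <;> simp [scale, scaleFun_coeff, HahnSeries.C_apply, h]

/-- Pairs of scalar matrices: `Γ` acts trivially on `ℂ`, so the consistency condition reads
`B A = A B` and gauge equivalence is simultaneous conjugation. -/
abbrev ScalarPair (r : ℕ) : Type := ConsistentPair r (RingHom.id ℂ) (RingHom.id ℂ)

/-- Consistent pairs over `ℂ((z))` for `σ f(z) = f(z/p)`, `τ f(z) = f(z/q)`, that is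
`B(z/p) A(z) = A(z/q) B(z)`. -/
abbrev FormalPair (r : ℕ) (p q : ℂˣ) : Type := ConsistentPair r (scale p) (scale q)

/-- `(A₀, B₀)` regarded as a consistent pair over `ℂ((z))`. -/
noncomputable abbrev ScalarPair.toFormal {r : ℕ} (p q : ℂˣ) (x : ScalarPair r) :
    FormalPair r p q :=
  ConsistentPair.map HahnSeries.C (scale_comp_C p) (scale_comp_C q) x

/-- The natural map `H¹(Γ, GL_r(ℂ)) → H¹(Γ, GL_r(ℂ((z))))`. -/
noncomputable def naturalMap (r : ℕ) (p q : ℂˣ) :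
    H1 r (RingHom.id ℂ) (RingHom.id ℂ) → H1 r (scale p) (scale q) :=
  H1.map HahnSeries.C (scale_comp_C p) (scale_comp_C q)

/-- An invertible complex matrix is `p`-restricted if its eigenvalues `c` satisfy
`1 ≤ |c| < |p|`. -/
def IsRestricted {r : ℕ} (p : ℂˣ) (A : GL (Fin r) ℂ) : Prop :=
  ∀ c : ℂ, Module.End.HasEigenvalue (Matrix.toLin' (A : Matrix (Fin r) (Fin r) ℂ)) c →
    1 ≤ ‖c‖ ∧ ‖c‖ < ‖(p : ℂ)‖

/-- The part `H¹(Γ, GL_r(ℂ))^{p-restricted}`: classes of the commuting pairs `(A₀, B₀)` with `A₀`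
`p`-restricted. -/
def H1Restricted (r : ℕ) (p : ℂˣ) : Set (H1 r (RingHom.id ℂ) (RingHom.id ℂ)) :=
  {c | ∃ x : ScalarPair r, IsRestricted p x.A ∧ Quotient.mk (gaugeSetoid r _ _) x = c}

/-! Write K = ℂ((z)). A consistent pair gives two commuting injective semilinear operators on row
vectors, Φ(v) = v(z/p) A and Ψ(v) = v(z/q) B, and a gauge transformation is a change of basis. The
task is to find a basis in which both operators have constant matrices.

For Φ alone, a Newton polygon argument over a ramified cover, followed by descent, gives an
eigenvector w of some power Φ^s with monomial eigenvalue c zⁿ (`exists_eigenvector`). The second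
operator then kills the exponent: comparing the two expressions for Φ^s Ψ^d w, where Ψ^d w is the
first iterate depending on the earlier ones, gives a relation between powers of p and q that forces
n = 0 (`exponent_eq_zero_of_commute`). Multiplying w by a power of z moves c into the annulus 1 ≤
|c| < |p^s|. On the Ψ-cyclic span of w the operator Φ^s is the constant c; induction on the
quotient, with extensions solved degree by degree, makes Φ^s constant and restricted in some basis
(`exists_constant_basis`).

The annulus meets each of its translates by a nonzero power of |p| trivially, so intertwiners of
restricted constant matrices are constant (`eq_map_C_of_intertwines`). This rigidity is used twice.
Since Φ and Ψ commute with Φ^s, their matrices in the basis found are constant. And a gauge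
transformation between restricted constant pairs is constant, which is uniqueness. -/

/-! ### Scaling operators on Laurent series -/

theorem scale_coeff (p : ℂˣ) (f : LaurentSeries ℂ) (n : ℤ) :
    (scale p f).coeff n = (p : ℂ) ^ (-n) * f.coeff n := rfl

theorem scale_mul_apply (p q : ℂˣ) (f : LaurentSeries ℂ) :
    scale (p * q) f = scale p (scale q f) := by
  ext n
  simp only [scale_coeff, Units.val_mul, mul_zpow, mul_assoc]

theorem scale_one_apply (f : LaurentSeries ℂ) : scale 1 f = f := by
  ext n
  simp [scale_coeff]

theorem scale_scale_inv (p : ℂˣ) (f : LaurentSeries ℂ) : scale p (scale p⁻¹ f) = f := by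
  rw [← scale_mul_apply, mul_inv_cancel, scale_one_apply]

theorem scale_comm (p q : ℂˣ) (f : LaurentSeries ℂ) :
    scale p (scale q f) = scale q (scale p f) := by
  rw [← scale_mul_apply, mul_comm, scale_mul_apply]

theorem scale_C (p : ℂˣ) (c : ℂ) : scale p (HahnSeries.C c) = HahnSeries.C c :=
  RingHom.congr_fun (scale_comp_C p) c

theorem scale_single (p : ℂˣ) (n : ℤ) (c : ℂ) :
    scale p (HahnSeries.single n c) = HahnSeries.single n ((p : ℂ) ^ (-n) * c) := by
  ext m
  by_cases h : m = n <;> simp [scale_coeff, h]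

theorem coeff_C_mul (c : ℂ) (f : LaurentSeries ℂ) (n : ℤ) :
    (HahnSeries.C c * f).coeff n = c * f.coeff n := by
  rw [HahnSeries.C_mul_eq_smul, HahnSeries.coeff_smul, smul_eq_mul]

theorem coeff_mul_C (c : ℂ) (f : LaurentSeries ℂ) (n : ℤ) :
    (f * HahnSeries.C c).coeff n = f.coeff n * c := by
  rw [mul_comm, coeff_C_mul, mul_comm]

/-! ### Rigidity of restricted constant matrices -/

/-- The matrix of the `n`-th coefficients of a matrix of Laurent series. -/
def coeffMatrix {ι : Type*} (X : Matrix ι ι (LaurentSeries ℂ)) (n : ℤ) : Matrix ι ι ℂ :=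
  X.map fun f => f.coeff n

/-- The spectrum of `A` lies in the annulus `1 ≤ |c| < |p|`. -/
def SpectrumRestricted {ι : Type*} [Fintype ι] [DecidableEq ι] (p : ℂˣ) (A : Matrix ι ι ℂ) :
    Prop :=
  ∀ c ∈ spectrum ℂ A, 1 ≤ ‖c‖ ∧ ‖c‖ < ‖(p : ℂ)‖

theorem isRestricted_iff {r : ℕ} (p : ℂˣ) (A : GL (Fin r) ℂ) :
    IsRestricted p A ↔ SpectrumRestricted p (A : Matrix (Fin r) (Fin r) ℂ) := by
  simp only [IsRestricted, SpectrumRestricted, Module.End.hasEigenvalue_iff_mem_spectrum,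
    Matrix.spectrum_toLin']

/-- Let χ be the characteristic polynomial of A. Then χ(A) X = X χ(B), where χ(A) = 0 by
Cayley–Hamilton and χ(B) is invertible because no eigenvalue of B is a root of χ. -/
theorem Matrix.eq_zero_of_intertwines_of_disjoint_spectrum {ι : Type*} [Fintype ι] [DecidableEq ι]
    {A B X : Matrix ι ι ℂ} (h : A * X = X * B) (hd : ∀ c ∈ spectrum ℂ A, c ∉ spectrum ℂ B) :
    X = 0 := by
  cases isEmpty_or_nonempty ι
  · exact Subsingleton.elim _ _
  have hpoly (f : Polynomial ℂ) : Polynomial.aeval A f * X = X * Polynomial.aeval B f := by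
    induction f using Polynomial.induction_on' with
    | add f g hf hg => simp only [map_add, add_mul, mul_add, hf, hg]
    | monomial n a =>
      have hn : A ^ n * X = X * B ^ n := by
        induction n with
        | zero => simp
        | succ n ih => rw [pow_succ, mul_assoc, h, ← mul_assoc, ih, mul_assoc, ← pow_succ]
      simp only [Polynomial.aeval_monomial, hn, Algebra.algebraMap_eq_smul_one,
        smul_mul_assoc, one_mul, mul_smul_comm]
  have hu : IsUnit (Polynomial.aeval B A.charpoly) := by
    rw [← spectrum.zero_notMem_iff (R := ℂ), spectrum.map_polynomial_aeval_of_nonempty]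
    · rintro ⟨c, hc, h0⟩
      exact hd c (Matrix.mem_spectrum_iff_isRoot_charpoly.2 h0) hc
    · exact spectrum.nonempty_of_isAlgClosed_of_finiteDimensional ℂ B
  have h1 := hpoly A.charpoly
  rw [Matrix.aeval_self_charpoly, zero_mul] at h1
  exact (hu.mul_left_eq_zero).1 h1.symm

theorem zpow_exponent_eq_zero_of_mem_annulus {x y P : ℝ} (hP : 1 < P) (hx : 1 ≤ x)
    (hx' : x < P) (hy : 1 ≤ y)
    (hy' : y < P) {n : ℤ} (h : x = P ^ n * y) : n = 0 := by
  have hP0 : 0 < P := by linarith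
  rcases lt_trichotomy n 0 with hn | hn | hn
  · have : P ^ n ≤ P ^ (-1 : ℤ) := zpow_le_zpow_right₀ hP.le (by omega)
    rw [zpow_neg_one] at this
    have h2 : P ^ n * y < P⁻¹ * P := by
      calc P ^ n * y ≤ P⁻¹ * y := by gcongr
        _ < P⁻¹ * P := by gcongr
    rw [inv_mul_cancel₀ hP0.ne'] at h2
    linarith
  · exact hn
  · have : P ^ (1 : ℤ) ≤ P ^ n := zpow_le_zpow_right₀ hP.le (by omega)
    rw [zpow_one] at this
    nlinarith

/-- Intertwiners over `ℂ((z))` of restricted constant matrices are constant. -/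
theorem eq_map_C_of_intertwines {ι : Type*} [Fintype ι] [DecidableEq ι] {p : ℂˣ}
    (hp : 1 < ‖(p : ℂ)‖) {A B : Matrix ι ι ℂ} (hA : SpectrumRestricted p A)
    (hB : SpectrumRestricted p B) {X : Matrix ι ι (LaurentSeries ℂ)}
    (h : X.map (scale p) * B.map HahnSeries.C = A.map HahnSeries.C * X) :
    X = (coeffMatrix X 0).map HahnSeries.C := by
  -- In degree n the equation reads A Xₙ = Xₙ (p⁻ⁿ B), and for n ≠ 0 the factor p⁻ⁿ moves the
  -- spectrum of B off the annulus containing that of A.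
  have key (n : ℤ) (hn : n ≠ 0) : coeffMatrix X n = 0 := by
    refine Matrix.eq_zero_of_intertwines_of_disjoint_spectrum (A := A)
      (B := (p : ℂ) ^ (-n) • B) ?_ ?_
    · ext i j
      have := congrArg (fun f : LaurentSeries ℂ => f.coeff n) (congrFun (congrFun h i) j)
      simp only [Matrix.mul_apply, Matrix.map_apply, HahnSeries.coeff_sum, coeff_mul_C,
        coeff_C_mul, scale_coeff] at this
      simp only [coeffMatrix, Matrix.mul_apply, Matrix.map_apply, Matrix.smul_apply, smul_eq_mul]
      rw [← this]
      exact Finset.sum_congr rfl fun k _ => by ring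
    · intro c hc hc'
      have hu : ((p ^ (-n) : ℂˣ) : ℂ) = (p : ℂ) ^ (-n) := Units.val_zpow_eq_zpow_val _ _
      rw [← hu, ← Units.smul_def, spectrum.unit_smul_eq_smul] at hc'
      obtain ⟨d, hd, rfl⟩ := hc'
      have h1 := hA _ hc
      have h2 := hB _ hd
      refine hn (neg_eq_zero.1 (zpow_exponent_eq_zero_of_mem_annulus hp h1.1 h1.2 h2.1 h2.2 ?_))
      simp only [smul_eq_mul, norm_mul, hu, norm_zpow]
  ext i j n
  by_cases hn : n = 0
  · simp [hn, coeffMatrix, HahnSeries.C_apply]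
  · have := congrFun (congrFun (key n hn) i) j
    simp only [coeffMatrix, Matrix.map_apply, Matrix.zero_apply] at this
    simp [this, HahnSeries.C_apply, hn]

/-! ### Semilinear operators and cyclic vectors -/

section TwistedLinear

section

variable {V : Type*} [AddCommGroup V]

theorem end_pow_succ_apply (Φ : AddMonoid.End V) (n : ℕ) (v : V) :
    (Φ ^ (n + 1)) v = Φ ((Φ ^ n) v) := by
  rw [pow_succ']
  rfl

theorem end_pow_injective {Φ : AddMonoid.End V} (h : Function.Injective Φ) (n : ℕ) :
    Function.Injective (Φ ^ n) := by
  induction n with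
  | zero => exact fun x y hxy => hxy
  | succ n ih =>
    intro x y hxy
    rw [end_pow_succ_apply, end_pow_succ_apply] at hxy
    exact ih (h hxy)

end

variable {K V : Type*} [Field K] [AddCommGroup V] [Module K V]

/-- Additive endomorphisms `Φ` with `Φ(g v) = σ(g) Φ(v)`. -/
def IsTwistedLinear (σ : K →+* K) (Φ : AddMonoid.End V) : Prop :=
  ∀ (g : K) (v : V), Φ (g • v) = σ g • Φ v

/-- Surjectivity of σ lets a relation among the images be pulled back, coefficients included, to a
relation among the original vectors. -/
theorem IsTwistedLinear.linearIndependent_comp {σ : K →+* K} {Φ : AddMonoid.End V}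
    (h : IsTwistedLinear σ Φ) (hσ : Function.Surjective σ) (hinj : Function.Injective Φ)
    {ι : Type*} {v : ι → V}
    (hv : LinearIndependent K v) :
    LinearIndependent K fun i => Φ (v i) := by
  obtain ⟨σ', hσ'⟩ := hσ.hasRightInverse
  refine hv.map_of_injective_injective (R := K) (R' := K) σ' Φ ?_ ?_ ?_
  · intro r hr
    rw [← hσ' r, hr, map_zero]
  · intro m hm
    exact hinj (hm.trans (map_zero Φ).symm)
  · intro r m
    exact (h _ _).trans (congrArg (fun c => c • Φ m) (hσ' r))

/-- The nonvanishing of `g 0` is what injectivity of Φ buys: it anchors the Newton polygon at index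
0 and carries the comparison that eliminates the exponent. -/
theorem IsTwistedLinear.exists_cyclic [FiniteDimensional K V] {σ : K →+* K}
    {Φ : AddMonoid.End V} (h : IsTwistedLinear σ Φ) (hσ : Function.Surjective σ)
    (hinj : Function.Injective Φ) {w : V}
    (hw : w ≠ 0) :
    ∃ (d : ℕ) (g : ℕ → K), 0 < d ∧
      LinearIndependent K (fun i : Fin d => (Φ ^ (i : ℕ)) w) ∧
      (Φ ^ d) w = ∑ i ∈ Finset.range d, g i • (Φ ^ i) w ∧ g 0 ≠ 0 := by
  classical
  have hex : ∃ d : ℕ,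
      ¬ LinearIndependent K (fun i : Fin (d + 1) => (Φ ^ (i : ℕ)) w) := by
    refine ⟨Module.finrank K V, fun hli => ?_⟩
    have := hli.fintype_card_le_finrank
    simp at this
  let d := Nat.find hex
  have hd : ¬ LinearIndependent K (fun i : Fin (d + 1) => (Φ ^ (i : ℕ)) w) :=
    Nat.find_spec hex
  have hd0 : 0 < d := by
    rw [Nat.pos_iff_ne_zero]
    intro h0
    rw [h0] at hd
    refine hd ?_
    change LinearIndependent K (fun i : Fin 1 => (Φ ^ (i : ℕ)) w)
    exact linearIndependent_unique_iff.2 hw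
  obtain ⟨e, he⟩ : ∃ e, d = e + 1 := ⟨d - 1, by omega⟩
  have hli : LinearIndependent K (fun i : Fin d => (Φ ^ (i : ℕ)) w) := by
    have : e < Nat.find hex := by change e < d; omega
    have := Nat.find_min hex this
    rw [not_not] at this
    rw [he]
    exact this
  have hmem : (Φ ^ d) w ∈ Submodule.span K
      (Set.range fun i : Fin d => (Φ ^ (i : ℕ)) w) := by
    by_contra hn
    refine hd ?_
    have h2 := (linearIndependent_finSnoc (x := (Φ ^ d) w)).2 ⟨hli, hn⟩
    convert h2 using 1
    ext i
    refine Fin.lastCases ?_ (fun j => ?_) i <;> simp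
  obtain ⟨c, hc⟩ := (Submodule.mem_span_range_iff_exists_fun _).1 hmem
  let g : ℕ → K := fun i => if hi : i < d then c ⟨i, hi⟩ else 0
  have hg : (Φ ^ d) w = ∑ i ∈ Finset.range d, g i • (Φ ^ i) w := by
    rw [← hc, Finset.sum_range]
    exact Finset.sum_congr rfl fun i _ => by simp [g]
  -- If g₀ = 0, then Φ^d w is a combination of Φ w, …, Φ^(d-1) w, contradicting the independence of
  -- the Φ-images of w, …, Φ^(d-1) w.
  refine ⟨d, g, hd0, hli, hg, fun h0 => ?_⟩
  have hli2 := h.linearIndependent_comp hσ hinj hli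
  rw [he] at hli2 hg
  rw [Finset.sum_range_succ', h0, zero_smul, add_zero] at hg
  have := Fintype.linearIndependent_iff.1 hli2
    (fun i => if (i : ℕ) = e then -1 else g (i + 1)) ?_ (Fin.last e)
  · simp at this
  · rw [Fin.sum_univ_castSucc]
    simp only [Fin.val_castSucc, Fin.val_last, if_true, ← end_pow_succ_apply, neg_smul, one_smul]
    rw [hg, Finset.sum_range, ← sub_eq_add_neg, sub_eq_zero]
    refine Finset.sum_congr rfl fun i _ => ?_
    rw [if_neg (by omega)]

theorem IsTwistedLinear.map_mem_span {σ : K →+* K} {Φ : AddMonoid.End V} (h : IsTwistedLinear σ Φ)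
    {s : Set V} {W : Submodule K V} (hs : ∀ x ∈ s, Φ x ∈ W) {x : V}
    (hx : x ∈ Submodule.span K s) : Φ x ∈ W := by
  induction hx using Submodule.span_induction with
  | mem x hx => exact hs x hx
  | zero => rw [map_zero]; exact W.zero_mem
  | add x y _ _ hx hy => rw [map_add]; exact W.add_mem hx hy
  | smul a x _ hx => rw [h]; exact W.smul_mem _ hx

theorem IsTwistedLinear.cyclic_span_stable {σ : K →+* K} {Φ : AddMonoid.End V}
    (h : IsTwistedLinear σ Φ)
    {w : V} {d : ℕ} {g : ℕ → K}
    (hg : (Φ ^ d) w = ∑ i ∈ Finset.range d, g i • (Φ ^ i) w) {x : V}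
    (hx : x ∈ Submodule.span K (Set.range fun i : Fin d => (Φ ^ (i : ℕ)) w)) :
    Φ x ∈ Submodule.span K (Set.range fun i : Fin d => (Φ ^ (i : ℕ)) w) := by
  refine h.map_mem_span ?_ hx
  rintro _ ⟨i, rfl⟩
  have hlt (j : ℕ) (hj : j < d) : (Φ ^ j) w ∈
      Submodule.span K (Set.range fun i : Fin d => (Φ ^ (i : ℕ)) w) :=
    Submodule.subset_span ⟨⟨j, hj⟩, rfl⟩
  rw [← end_pow_succ_apply]
  rcases Nat.lt_or_ge ((i : ℕ) + 1) d with hi | hi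
  · exact hlt _ hi
  · have : (i : ℕ) + 1 = d := by omega
    rw [this, hg]
    exact Submodule.sum_mem _ fun j hj => Submodule.smul_mem _ _ (hlt j (Finset.mem_range.1 hj))

/-- An injective scale-linear map induces an injective map on the quotient by a stable subspace. -/
theorem IsTwistedLinear.mem_of_map_mem [FiniteDimensional K V] {σ : K →+* K}
    {Φ : AddMonoid.End V} (h : IsTwistedLinear σ Φ) (hσ : Function.Surjective σ)
    (hinj : Function.Injective Φ)
    {W : Submodule K V} (hW : ∀ x ∈ W, Φ x ∈ W) {x : V} (hx : Φ x ∈ W) :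
    x ∈ W := by
  by_contra hxW
  let b := Module.finBasis K W
  have hb : LinearIndependent K fun i => (b i : V) :=
    b.linearIndependent.map' W.subtype W.ker_subtype
  have hspan : Submodule.span K (Set.range fun i => (b i : V)) ≤ W := by
    rw [Submodule.span_le]
    rintro _ ⟨i, rfl⟩
    exact (b i).2
  -- Adjoining x to a basis of W gives dim W + 1 independent vectors whose images are independent
  -- and all lie in W, too many for its dimension.
  have h1 := (linearIndependent_finCons (x := x)).2 ⟨hb, fun hmem => hxW (hspan hmem)⟩
  have h2 := h.linearIndependent_comp hσ hinj h1
  have hmem (i : Fin (Module.finrank K W + 1)) :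
      Φ ((Fin.cons x (fun i => (b i : V)) : Fin _ → V) i) ∈ W := by
    refine Fin.cases ?_ (fun j => ?_) i
    · simpa using hx
    · simpa using hW _ (b j).2
  have h3 : LinearIndependent K (fun i => (⟨_, hmem i⟩ : W)) :=
    LinearIndependent.of_comp W.subtype h2
  have := h3.fintype_card_le_finrank
  simp at this

end TwistedLinear

theorem scale_surjective (p : ℂˣ) : Function.Surjective (scale p) :=
  fun f => ⟨_, scale_scale_inv p f⟩

theorem IsTwistedLinear.pow_scale {V : Type*} [AddCommGroup V] [Module (LaurentSeries ℂ) V]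
    {p : ℂˣ} {Φ : AddMonoid.End V} (h : IsTwistedLinear (scale p) Φ) (n : ℕ) :
    IsTwistedLinear (scale (p ^ n)) (Φ ^ n) := by
  induction n with
  | zero =>
    intro g v
    rw [pow_zero, pow_zero, scale_one_apply]
    rfl
  | succ n ih =>
    intro g v
    rw [end_pow_succ_apply, end_pow_succ_apply, ih, h, pow_succ', scale_mul_apply]

/-! ### Power series solutions of scaling equations -/

/-- Triangular recursions with nonzero diagonal in positive degrees are solvable. -/
theorem exists_triangular_solution (k : ℕ → ℕ → ℂ) (h0 : k 0 0 = 0)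
    (h : ∀ n, 0 < n → k n n ≠ 0) :
    ∃ F : ℕ → ℂ, F 0 = 1 ∧ ∀ n, ∑ m ∈ Finset.range (n + 1), k n m * F m = 0 := by
  let F : ℕ → ℂ := fun n => Nat.strongRecOn (motive := fun _ => ℂ) n (fun n ih =>
    if n = 0 then 1 else -(k n n)⁻¹ * ∑ m : Fin n, k n m * ih m m.2)
  have hF (n : ℕ) : F n = if n = 0 then 1 else -(k n n)⁻¹ * ∑ m : Fin n, k n m * F m :=
    Nat.strongRecOn_eq (motive := fun _ => ℂ) _ _
  refine ⟨F, by rw [hF, if_pos rfl], fun n => ?_⟩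
  rcases Nat.eq_zero_or_pos n with rfl | hn
  · simp [h0]
  · rw [Finset.sum_range_succ, hF n, if_neg hn.ne', Finset.sum_range]
    have := h n hn
    field_simp
    ring

/-- A power series solution of `∑ cⁱ Gᵢ(z) F(aⁱ z) = 0` with `|a| < 1`, for a suitable `c`. -/
theorem exists_powerSeries_solution (d : ℕ) (G : ℕ → PowerSeries ℂ) {a : ℂ}
    (ha : ‖a‖ < 1) (hG0 : PowerSeries.constantCoeff (G 0) ≠ 0) {i : ℕ} (hi0 : 0 < i)
    (hid : i ≤ d) (hGi : PowerSeries.constantCoeff (G i) ≠ 0) :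
    ∃ (c : ℂ) (F : PowerSeries ℂ), c ≠ 0 ∧ PowerSeries.constantCoeff F = 1 ∧
      ∑ j ∈ Finset.range (d + 1),
        PowerSeries.C (c ^ j) * (G j * PowerSeries.rescale (a ^ j) F) = 0 := by
  -- The indicial polynomial. Two nonzero coefficients, at 0 and at i > 0, guarantee a root and
  -- exclude the root 0.
  let χ : Polynomial ℂ := ∑ j ∈ Finset.range (d + 1),
    Polynomial.monomial j (PowerSeries.constantCoeff (G j))
  have hcoeff (j : ℕ) (hj : j ≤ d) : χ.coeff j = PowerSeries.constantCoeff (G j) := by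
    simp only [χ, Polynomial.finsetSum_coeff, Polynomial.coeff_monomial]
    rw [Finset.sum_ite_eq', if_pos (Finset.mem_range.2 (by omega))]
  have hχ : χ ≠ 0 := fun h => hG0 (by rw [← hcoeff 0 (Nat.zero_le d), h, Polynomial.coeff_zero])
  have hdeg : χ.degree ≠ 0 := by
    have : (i : WithBot ℕ) ≤ χ.degree :=
      Polynomial.le_degree_of_ne_zero (by rwa [hcoeff i hid])
    intro h
    rw [h] at this
    have : i ≤ 0 := by exact_mod_cast this
    omega
  have hne : χ.roots.toFinset.Nonempty := by
    obtain ⟨c, hc⟩ := IsAlgClosed.exists_root χ hdeg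
    exact ⟨c, by simpa [hχ] using hc⟩
  -- A root of least modulus avoids resonance: |c aⁿ| < |c| for n > 0, so c aⁿ is not a root.
  obtain ⟨c, hc, hmin⟩ := Finset.exists_min_image χ.roots.toFinset (fun c => ‖c‖) hne
  have hc' : χ.eval c = 0 := by
    simpa [hχ] using hc
  have hc0 : c ≠ 0 := by
    rintro rfl
    rw [← Polynomial.coeff_zero_eq_eval_zero, hcoeff 0 (Nat.zero_le d)] at hc'
    exact hG0 hc'
  have heval (x : ℂ) : χ.eval x =
      ∑ j ∈ Finset.range (d + 1), PowerSeries.constantCoeff (G j) * x ^ j := by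
    simp only [χ, Polynomial.eval_finsetSum, Polynomial.eval_monomial]
  -- `k n m` is the weight of the m-th coefficient of F in degree n of the equation; the truncated
  -- subtraction is harmless since only m ≤ n occurs.
  let k : ℕ → ℕ → ℂ := fun n m =>
    ∑ j ∈ Finset.range (d + 1), c ^ j * (PowerSeries.coeff (n - m) (G j) * (a ^ j) ^ m)
  have hk (n : ℕ) : k n n = χ.eval (c * a ^ n) := by
    rw [heval]
    refine Finset.sum_congr rfl fun j _ => ?_
    rw [Nat.sub_self, PowerSeries.coeff_zero_eq_constantCoeff_apply, mul_pow, ← pow_mul, ← pow_mul,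
      mul_comm n j]
    ring
  obtain ⟨F, hF0, hF⟩ := exists_triangular_solution k (by rw [hk, pow_zero, mul_one, hc'])
    (fun n hn hkn => by
      rw [hk] at hkn
      have h1 := hmin (c * a ^ n) (by simpa [hχ] using hkn)
      rw [norm_mul, norm_pow] at h1
      have h2 : ‖a‖ ^ n < 1 := pow_lt_one₀ (norm_nonneg a) ha hn.ne'
      have h3 : 0 < ‖c‖ := norm_pos_iff.2 hc0
      nlinarith)
  refine ⟨c, PowerSeries.mk F, hc0, by simp [hF0], ?_⟩
  ext n
  rw [map_sum, map_zero, ← hF n]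
  simp only [k, Finset.sum_mul]
  rw [Finset.sum_comm]
  refine Finset.sum_congr rfl fun j _ => ?_
  rw [PowerSeries.coeff_C_mul, PowerSeries.coeff_mul,
    Finset.Nat.sum_antidiagonal_eq_sum_range_succ_mk, Finset.mul_sum, ← Finset.sum_range_reflect]
  refine Finset.sum_congr rfl fun m hm => ?_
  have hm' : m ≤ n := by have := Finset.mem_range.1 hm; omega
  have e1 : n + 1 - 1 - m = n - m := by omega
  have e2 : n - (n - m) = m := by omega
  simp only [e1, e2, PowerSeries.coeff_rescale, PowerSeries.coeff_mk]
  ring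

/-! ### Ramification and its descent -/

/-- The substitution `z ↦ z ^ b` on Laurent series. -/
noncomputable def ramify (b : ℕ) [NeZero b] : LaurentSeries ℂ →+* LaurentSeries ℂ :=
  HahnSeries.embDomainRingHom (AddMonoidHom.mulLeft (b : ℤ))
    (fun _ _ h => mul_left_cancel₀ (Nat.cast_ne_zero.2 (NeZero.ne b)) h)
    (fun _ _ => mul_le_mul_iff_right₀ (by exact_mod_cast NeZero.pos b))

theorem ramify_coeff_mul (b : ℕ) [NeZero b] (f : LaurentSeries ℂ) (n : ℤ) :
    (ramify b f).coeff (b * n) = f.coeff n :=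
  HahnSeries.embDomain_coeff (f := ⟨⟨_, _⟩, _⟩) (a := n)

theorem exists_of_ramify_coeff_ne_zero {b : ℕ} [NeZero b] {f : LaurentSeries ℂ} {n : ℤ}
    (h : (ramify b f).coeff n ≠ 0) : ∃ k, n = b * k ∧ f.coeff k ≠ 0 := by
  by_contra! hn
  by_cases hb : ∃ k, n = b * k
  · obtain ⟨k, rfl⟩ := hb
    rw [ramify_coeff_mul] at h
    exact h (hn k rfl)
  · refine h (HahnSeries.embDomain_of_notMem_range ?_)
    rintro ⟨k, hk⟩
    exact hb ⟨k, hk.symm⟩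

theorem ramify_single (b : ℕ) [NeZero b] (n : ℤ) (c : ℂ) :
    ramify b (HahnSeries.single n c) = HahnSeries.single (b * n) c :=
  HahnSeries.embDomain_single

theorem scale_ramify (π : ℂˣ) (b : ℕ) [NeZero b] (f : LaurentSeries ℂ) :
    scale π (ramify b f) = ramify b (scale (π ^ b) f) := by
  ext n
  by_cases hb : ∃ k, n = b * k
  · obtain ⟨k, rfl⟩ := hb
    rw [scale_coeff, ramify_coeff_mul, ramify_coeff_mul, scale_coeff, Units.val_pow_eq_pow_val,
      ← zpow_natCast, ← zpow_mul, mul_neg]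
  · have h0 (g : LaurentSeries ℂ) : (ramify b g).coeff n = 0 := by
      by_contra h
      obtain ⟨k, hk, -⟩ := exists_of_ramify_coeff_ne_zero h
      exact hb ⟨k, hk⟩
    rw [scale_coeff, h0, h0, mul_zero]

/-- The part of a Laurent series in `z` that is a series in `z ^ b`, read as a series in
`z ^ b`. -/
noncomputable def unramify (b : ℕ) [NeZero b] : LaurentSeries ℂ →+ LaurentSeries ℂ where
  toFun f :=
    { coeff := fun n => f.coeff (b * n)
      isPWO_support' := by
        intro u
        obtain ⟨i, j, hij, h⟩ := f.isPWO_support fun n => ⟨b * (u n : ℤ), (u n).2⟩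
        exact ⟨i, j, hij, le_of_mul_le_mul_left h (by exact_mod_cast NeZero.pos b)⟩ }
  map_zero' := by
    ext n
    rfl
  map_add' f g := by
    ext n
    rfl

theorem unramify_coeff (b : ℕ) [NeZero b] (f : LaurentSeries ℂ) (n : ℤ) :
    (unramify b f).coeff n = f.coeff (b * n) := rfl

theorem unramify_scale (b : ℕ) [NeZero b] (π : ℂˣ) (f : LaurentSeries ℂ) :
    unramify b (scale π f) = scale (π ^ b) (unramify b f) := by
  ext n
  rw [unramify_coeff, scale_coeff, scale_coeff, unramify_coeff, Units.val_pow_eq_pow_val,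
      ← zpow_natCast, ← zpow_mul, mul_neg]

/-- A projection formula: it turns functionals semilinear over z ↦ z^b into linear ones. -/
theorem unramify_ramify_mul (b : ℕ) [NeZero b] (f g : LaurentSeries ℂ) :
    unramify b (ramify b f * g) = f * unramify b g := by
  have hb : (b : ℤ) ≠ 0 := Nat.cast_ne_zero.2 (NeZero.ne b)
  ext n
  rw [unramify_coeff, HahnSeries.coeff_mul, HahnSeries.coeff_mul]
  symm
  refine Finset.sum_bij (fun x _ => ((b : ℤ) * x.1, (b : ℤ) * x.2)) ?_ ?_ ?_ ?_
  · rintro ⟨x, y⟩ h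
    obtain ⟨h1, h2, h3⟩ := Finset.mem_antidiagonal.1 h
    refine Finset.mem_antidiagonal.2 ⟨?_, h2, ?_⟩
    · rw [HahnSeries.mem_support, ramify_coeff_mul]
      exact h1
    · dsimp only at h3 ⊢
      rw [← h3, mul_add]
  · rintro ⟨x, y⟩ _ ⟨x', y'⟩ _ h
    rw [Prod.mk.injEq] at h ⊢
    exact ⟨mul_left_cancel₀ hb h.1, mul_left_cancel₀ hb h.2⟩
  · rintro ⟨x, y⟩ h
    obtain ⟨h1, h2, h3⟩ := Finset.mem_antidiagonal.1 h
    obtain ⟨k, hk, hk'⟩ := exists_of_ramify_coeff_ne_zero h1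
    dsimp only at hk h3 h2
    have hy : y = b * (n - k) := by rw [mul_sub, ← h3, hk]; ring
    refine ⟨(k, n - k), Finset.mem_antidiagonal.2 ⟨hk', ?_, ?_⟩, ?_⟩
    · rw [hy] at h2
      exact h2
    · dsimp only
      ring
    · rw [hk, hy]
  · rintro ⟨x, y⟩ _
    rw [ramify_coeff_mul, unramify_coeff]

/-! ### Newton polygon and ramified solutions -/

/-- The rank-one twisted operator `f(z) ↦ c zᵐ f(z/p)`. -/
noncomputable def rankOne (p : ℂˣ) (m : ℤ) (c : ℂ) : AddMonoid.End (LaurentSeries ℂ) :=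
  (AddMonoidHom.mulLeft (HahnSeries.single m c : LaurentSeries ℂ)).comp
    (scale p : LaurentSeries ℂ →+ LaurentSeries ℂ)

theorem rankOne_apply (p : ℂˣ) (m : ℤ) (c : ℂ) (f : LaurentSeries ℂ) :
    rankOne p m c f = HahnSeries.single m c * scale p f := rfl

/-- The scalar factor in the iterates of `rankOne`. -/
noncomputable def rankOneFactor (p : ℂˣ) (m : ℤ) (i : ℕ) : ℂ :=
  ∏ k ∈ Finset.range i, (p : ℂ) ^ (-(m * k))

theorem rankOneFactor_ne_zero (p : ℂˣ) (m : ℤ) (i : ℕ) : rankOneFactor p m i ≠ 0 :=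
  Finset.prod_ne_zero_iff.2 fun _ _ => zpow_ne_zero _ p.ne_zero

theorem rankOne_pow_apply (p : ℂˣ) (m : ℤ) (c : ℂ) (i : ℕ) (f : LaurentSeries ℂ) :
    (rankOne p m c ^ i) f =
      HahnSeries.single (m * i) (rankOneFactor p m i * c ^ i) * scale (p ^ i) f := by
  induction i with
  | zero =>
    simp [rankOneFactor, scale_one_apply]
  | succ i ih =>
    rw [end_pow_succ_apply, ih, rankOne_apply, map_mul, scale_single, ← mul_assoc,
      HahnSeries.single_mul_single, ← scale_mul_apply, ← pow_succ']
    have e1 : m + m * (i : ℤ) = m * ((i + 1 : ℕ) : ℤ) := by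
      push_cast
      ring
    have e2 : c * ((p : ℂ) ^ (-(m * (i : ℤ))) * (rankOneFactor p m i * c ^ i)) =
        rankOneFactor p m (i + 1) * c ^ (i + 1) := by
      simp only [rankOneFactor, Finset.prod_range_succ]
      ring
    rw [e1, e2]

theorem ofPowerSeries_rescale_inv (p : ℂˣ) (F : PowerSeries ℂ) (a : ℂ) (ha : a = (p : ℂ)⁻¹) :
    HahnSeries.ofPowerSeries ℤ ℂ (PowerSeries.rescale a F) =
      scale p (HahnSeries.ofPowerSeries ℤ ℂ F) := by
  ext n
  rw [scale_coeff, PowerSeries.coeff_coe, PowerSeries.coeff_coe]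
  split_ifs with h
  · rw [mul_zero]
  · obtain ⟨k, rfl⟩ := Int.eq_ofNat_of_zero_le (not_lt.1 h)
    rw [PowerSeries.coeff_rescale, ha, Int.natAbs_natCast, zpow_neg, zpow_natCast, inv_pow]

/-- After ramification, every linear `p`-difference equation has a nonzero formal solution of
the form (character) × (series). -/
theorem exists_ramified_solution {p : ℂˣ} (hp : 1 < ‖(p : ℂ)‖) {d : ℕ} (hd : 0 < d)
    (a : ℕ → LaurentSeries ℂ) (ha0 : a 0 ≠ 0) (had : a d ≠ 0) :
    ∃ (b : ℕ) (_ : NeZero b) (m : ℤ) (c : ℂ) (π : ℂˣ) (f : LaurentSeries ℂ),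
      c ≠ 0 ∧ π ^ b = p ∧ f.coeff 0 = 1 ∧
      ∑ i ∈ Finset.range (d + 1), ramify b (a i) * (rankOne π m c ^ i) f = 0 := by
  classical
  let v : ℕ → ℤ := fun i => (a i).order
  -- The lowest Newton polygon slope from index 0 is reached at index b. Its denominator divides b,
  -- so ramifying by b makes the exponent m integral; after the twist both indices 0 and b
  -- contribute to the lowest degree.
  obtain ⟨b, hb, hmin⟩ := Finset.exists_min_image
    ((Finset.Icc 1 d).filter fun i => a i ≠ 0) (fun i => ((v i - v 0 : ℤ) : ℚ) / i)
    ⟨d, by simp [had]; omega⟩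
  simp only [Finset.mem_filter, Finset.mem_Icc] at hb hmin
  obtain ⟨⟨hb1, hbd⟩, hab⟩ := hb
  have hbz : NeZero b := ⟨by omega⟩
  let m : ℤ := -(v b - v 0)
  have hslope (i : ℕ) (hi : i ≤ d) (hai : a i ≠ 0) : 0 ≤ b * v i + m * i - b * v 0 := by
    rcases Nat.eq_zero_or_pos i with rfl | hi0
    · simp
    · have h1 := hmin i ⟨⟨hi0, hi⟩, hai⟩
      rw [div_le_div_iff₀ (by exact_mod_cast hb1) (by exact_mod_cast hi0)] at h1
      have h2 : (v b - v 0) * i ≤ (v i - v 0) * b := by exact_mod_cast h1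
      simp only [m]
      linarith
  obtain ⟨π0, hπ0⟩ := IsAlgClosed.exists_pow_nat_eq (p : ℂ) (by omega : 0 < b)
  have hπne : π0 ≠ 0 := by
    rintro rfl
    rw [zero_pow (by omega)] at hπ0
    exact p.ne_zero hπ0.symm
  let π : ℂˣ := Units.mk0 π0 hπne
  have hπ : π ^ b = p := Units.ext (by simpa [π] using hπ0)
  have hπ1 : 1 < ‖π0‖ := by
    rw [← hπ0, norm_pow] at hp
    by_contra hle
    exact absurd hp (not_lt.2 (pow_le_one₀ (norm_nonneg _) (not_lt.1 hle)))
  -- The i-th coefficient of the twisted equation, without c^i and divided by z^(b·v 0). By `hslope`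
  -- it has no negative powers, and its constant term is nonzero at i = 0 and i = b.
  let h : ℕ → LaurentSeries ℂ := fun i =>
    ramify b (a i) * HahnSeries.single (m * i - b * v 0) (rankOneFactor π m i)
  let G : ℕ → PowerSeries ℂ := fun i => PowerSeries.mk fun n => (h i).coeff n
  have hG (i : ℕ) (hi : i ≤ d) : HahnSeries.ofPowerSeries ℤ ℂ (G i) = h i := by
    ext n
    rw [PowerSeries.coeff_coe]
    split_ifs with hn
    · by_contra hne
      rw [HahnSeries.coeff_mul_single] at hne
      obtain ⟨k, hk, hk'⟩ := exists_of_ramify_coeff_ne_zero (left_ne_zero_of_mul (Ne.symm hne))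
      have h1 : v i ≤ k := HahnSeries.order_le_of_coeff_ne_zero hk'
      have h2 := hslope i hi (fun h0 => hk' (by rw [h0, HahnSeries.coeff_zero]))
      have h3 : (b : ℤ) * v i ≤ b * k := by gcongr
      linarith
    · obtain ⟨k, rfl⟩ := Int.eq_ofNat_of_zero_le (not_lt.1 hn)
      rw [PowerSeries.coeff_mk, Int.natAbs_natCast]
  have hcc (i : ℕ) (hai : a i ≠ 0) (hi : (0 : ℤ) - (m * i - b * v 0) = b * v i) :
      PowerSeries.constantCoeff (G i) ≠ 0 := by
    rw [← PowerSeries.coeff_zero_eq_constantCoeff_apply, PowerSeries.coeff_mk, Nat.cast_zero,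
      HahnSeries.coeff_mul_single, hi, ramify_coeff_mul]
    exact mul_ne_zero (HahnSeries.coeff_order_eq_zero.not.2 hai) (rankOneFactor_ne_zero _ _ _)
  obtain ⟨c, F, hc, hF0, hF⟩ := exists_powerSeries_solution d G (a := π0⁻¹)
    (by rw [norm_inv]; exact inv_lt_one_of_one_lt₀ hπ1)
    (hcc 0 ha0 (by simp)) (i := b) (by omega) hbd (hcc b hab (by simp only [m]; ring))
  refine ⟨b, hbz, m, c, π, HahnSeries.ofPowerSeries ℤ ℂ F, hc, hπ, ?_, ?_⟩
  · have := LaurentSeries.coeff_coe_powerSeries F 0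
    rw [PowerSeries.coeff_zero_eq_constantCoeff_apply, hF0] at this
    exact_mod_cast this
  · have h1 := congrArg (fun f => HahnSeries.single ((b : ℤ) * v 0) (1 : ℂ) *
      HahnSeries.ofPowerSeries ℤ ℂ f) hF
    simp only [map_zero, mul_zero, map_sum, Finset.mul_sum, map_mul] at h1
    rw [← h1]
    refine Finset.sum_congr rfl fun i hi => ?_
    have hi' : i ≤ d := by have := Finset.mem_range.1 hi; omega
    rw [hG i hi', HahnSeries.ofPowerSeries_C, HahnSeries.C_apply,
      ofPowerSeries_rescale_inv (π ^ i) F _ (by simp [π]), rankOne_pow_apply]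
    simp only [h]
    have e : (HahnSeries.single (m * i) (rankOneFactor π m i * c ^ i) : LaurentSeries ℂ) =
        HahnSeries.single ((b : ℤ) * v 0) 1 * HahnSeries.single 0 (c ^ i) *
          HahnSeries.single (m * i - b * v 0) (rankOneFactor π m i) := by
      rw [HahnSeries.single_mul_single, HahnSeries.single_mul_single]
      have e1 : (b : ℤ) * v 0 + 0 + (m * i - b * v 0) = m * i := by ring
      rw [e1, one_mul, mul_comm (c ^ i)]
    rw [e]
    ring

/-! ### Eigenvectors of powers of a difference operator -/

/-- A twisted-linear functional on a cyclic module is determined by its value on the generator,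
which may be any solution of the corresponding equation. -/
theorem IsTwistedLinear.exists_functional {K V L : Type*} [Field K] [AddCommGroup V] [Module K V]
    [CommRing L] {σ : K →+* K} {Φ : AddMonoid.End V} (h : IsTwistedLinear σ Φ) {w : V} {d : ℕ}
    (hd : 0 < d) {g : ℕ → K} (hli : LinearIndependent K (fun i : Fin d => (Φ ^ (i : ℕ)) w))
    (hg : (Φ ^ d) w = ∑ i ∈ Finset.range d, g i • (Φ ^ i) w)
    (hspan : Submodule.span K (Set.range fun i : Fin d => (Φ ^ (i : ℕ)) w) = ⊤)
    (ρ : K →+* L) (T : AddMonoid.End L) (hT : ∀ a x, T (ρ a * x) = ρ (σ a) * T x) (f : L)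
    (hf : (T ^ d) f = ∑ i ∈ Finset.range d, ρ (g i) * (T ^ i) f) :
    ∃ l : V →+ L, (∀ a x, l (a • x) = ρ a * l x) ∧ (∀ x, l (Φ x) = T (l x)) ∧ l w = f := by
  let B := Module.Basis.mk hli hspan.ge
  have hB (i : Fin d) : B i = (Φ ^ (i : ℕ)) w := by simp [B]
  let l : V →+ L :=
    { toFun := fun x => ∑ i, ρ (B.repr x i) * (T ^ (i : ℕ)) f
      map_zero' := by simp
      map_add' := fun x y => by simp [add_mul, Finset.sum_add_distrib] }
  have hl (x : V) : l x = ∑ i, ρ (B.repr x i) * (T ^ (i : ℕ)) f := rfl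
  have hsmul (a : K) (x : V) : l (a • x) = ρ a * l x := by
    simp [hl, Finset.mul_sum, mul_assoc]
  have hlt (j : ℕ) (hj : j < d) : l ((Φ ^ j) w) = (T ^ j) f := by
    have := hB ⟨j, hj⟩
    dsimp only at this
    rw [← this, hl, Finset.sum_eq_single ⟨j, hj⟩]
    · simp
    · intro i _ hi
      simp [Finsupp.single_eq_of_ne hi]
    · simp
  have hld : l ((Φ ^ d) w) = (T ^ d) f := by
    rw [hg, hf, map_sum]
    refine Finset.sum_congr rfl fun i hi => ?_
    rw [hsmul, hlt i (Finset.mem_range.1 hi)]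
  refine ⟨l, hsmul, fun x => ?_, hlt 0 hd⟩
  have hx : x ∈ Submodule.span K (Set.range fun i : Fin d => (Φ ^ (i : ℕ)) w) :=
    hspan ▸ Submodule.mem_top
  induction hx using Submodule.span_induction with
  | mem x hx =>
    obtain ⟨i, rfl⟩ := hx
    dsimp only
    rw [← end_pow_succ_apply, hlt i i.2, ← end_pow_succ_apply]
    rcases Nat.lt_or_ge ((i : ℕ) + 1) d with hi | hi
    · exact hlt _ hi
    · have : (i : ℕ) + 1 = d := by omega
      rw [this, hld]
  | zero => simp only [map_zero]
  | add x y _ _ hx hy => simp only [map_add, hx, hy]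
  | smul a x _ hx => rw [h, hsmul, hsmul, hx, hT]

/-- The restriction of an additive endomorphism to a stable subspace. -/
def endRestrict {K V : Type*} [Field K] [AddCommGroup V] [Module K V] (Φ : AddMonoid.End V)
    (W : Submodule K V) (h : ∀ x ∈ W, Φ x ∈ W) : AddMonoid.End W where
  toFun x := ⟨Φ x, h x x.2⟩
  map_zero' := Subtype.ext (map_zero Φ)
  map_add' x y := Subtype.ext (map_add Φ (x : V) (y : V))

theorem coe_endRestrict_pow {K V : Type*} [Field K] [AddCommGroup V] [Module K V]
    (Φ : AddMonoid.End V) (W : Submodule K V) (h : ∀ x ∈ W, Φ x ∈ W) (n : ℕ) (x : W) :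
    (((endRestrict Φ W h) ^ n) x : V) = (Φ ^ n) x := by
  induction n with
  | zero => rfl
  | succ n ih =>
    rw [end_pow_succ_apply, end_pow_succ_apply, ← ih]
    rfl

theorem one_lt_norm_pow {p : ℂˣ} (hp : 1 < ‖(p : ℂ)‖) {s : ℕ} (hs : 0 < s) :
    1 < ‖((p ^ s : ℂˣ) : ℂ)‖ := by
  rw [Units.val_pow_eq_pow_val, norm_pow]
  exact one_lt_pow₀ hp hs.ne'

/-- A ramified solution of the cyclic equation defines a functional on V. Descended to ℂ((z)), its
kernel is stable under a power of Φ, hence zero by irreducibility; so V is a line, and the vector of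
value 1 is the eigenvector. -/
theorem exists_eigenvector_of_irreducible {V : Type*} [AddCommGroup V]
    [Module (LaurentSeries ℂ) V] [FiniteDimensional (LaurentSeries ℂ) V] {p : ℂˣ}
    (hp : 1 < ‖(p : ℂ)‖) {Φ : AddMonoid.End V} (h : IsTwistedLinear (scale p) Φ)
    (hinj : Function.Injective Φ) {w : V} (hw : w ≠ 0)
    (hirr : ∀ s : ℕ, 0 < s → ∀ W : Submodule (LaurentSeries ℂ) V,
      (∀ x ∈ W, (Φ ^ s) x ∈ W) → W = ⊥ ∨ W = ⊤) :
    ∃ (s : ℕ) (n : ℤ) (c : ℂ) (v : V), 0 < s ∧ c ≠ 0 ∧ v ≠ 0 ∧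
      (Φ ^ s) v = (HahnSeries.single n c : LaurentSeries ℂ) • v := by
  obtain ⟨d, g, hd, hli, hg, hg0⟩ := h.exists_cyclic (scale_surjective p) hinj hw
  have hspan : Submodule.span (LaurentSeries ℂ)
      (Set.range fun i : Fin d => (Φ ^ (i : ℕ)) w) = ⊤ := by
    refine (hirr 1 one_pos _ fun x hx => ?_).resolve_left fun h0 => hw ?_
    · rw [pow_one]
      exact h.cyclic_span_stable hg hx
    · have : w ∈ Submodule.span (LaurentSeries ℂ)
          (Set.range fun i : Fin d => (Φ ^ (i : ℕ)) w) :=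
        Submodule.subset_span ⟨⟨0, hd⟩, rfl⟩
      rw [h0] at this
      exact (Submodule.mem_bot _).1 this
  -- The value -1 at index d encodes the cyclic relation as a homogeneous equation.
  obtain ⟨b, _, m, c, π, f, hc, hπ, hf0, hf⟩ := exists_ramified_solution hp hd
    (fun i => if i < d then g i else -1) (by simpa [hd] using hg0) (by simp)
  have hf' : ((rankOne π m c) ^ d) f =
      ∑ i ∈ Finset.range d, ramify b (g i) * ((rankOne π m c) ^ i) f := by
    have e : ∑ i ∈ Finset.range d,
        ramify b (if i < d then g i else -1) * ((rankOne π m c) ^ i) f =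
          ∑ i ∈ Finset.range d, ramify b (g i) * ((rankOne π m c) ^ i) f :=
      Finset.sum_congr rfl fun i hi => by rw [if_pos (Finset.mem_range.1 hi)]
    rw [Finset.sum_range_succ, if_neg (lt_irrefl d), map_neg, map_one, e] at hf
    linear_combination -hf
  obtain ⟨l, hlsmul, hlΦ, hlw⟩ := h.exists_functional hd hli hg hspan (ramify b)
    (rankOne π m c) (fun a x => by
      rw [rankOne_apply, rankOne_apply, map_mul, scale_ramify, hπ]
      ring) f hf'
  have hlpow (n : ℕ) (x : V) : l ((Φ ^ n) x) = ((rankOne π m c) ^ n) (l x) := by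
    induction n with
    | zero => rfl
    | succ n ih => rw [end_pow_succ_apply, end_pow_succ_apply, hlΦ, ih]
  let l0 : V →ₗ[LaurentSeries ℂ] LaurentSeries ℂ :=
    { toFun := fun x => unramify b (l x)
      map_add' := fun x y => by rw [map_add, map_add]
      map_smul' := fun a x => by
        rw [hlsmul, unramify_ramify_mul]
        rfl }
  have hl0 (x : V) : l0 x = unramify b (l x) := rfl
  have hl0w : l0 w ≠ 0 := by
    intro h0
    have := congrArg (fun f : LaurentSeries ℂ => f.coeff 0) h0
    rw [hl0, hlw, unramify_coeff, mul_zero, hf0] at this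
    simp at this
  let c' := rankOneFactor π m b * c ^ b
  -- Descent needs the b-th power: its factor z^(mb) lies in the image of z ↦ z^b, while π^b = p
  -- becomes p^b downstairs.
  have hl0Φ (x : V) : l0 ((Φ ^ b) x) = HahnSeries.single m c' * scale (p ^ b) (l0 x) := by
    rw [hl0, hlpow, rankOne_pow_apply, mul_comm m, ← ramify_single, unramify_ramify_mul,
      unramify_scale, hπ, hl0]
  have hb : 0 < b := NeZero.pos b
  have hker : LinearMap.ker l0 = ⊥ := by
    refine (hirr b hb _ fun x hx => ?_).resolve_right fun h0 => hl0w ?_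
    · rw [LinearMap.mem_ker] at hx ⊢
      rw [hl0Φ, hx, map_zero, mul_zero]
    · rw [← LinearMap.mem_ker, h0]
      exact Submodule.mem_top
  have hx1 : l0 ((l0 w)⁻¹ • w) = 1 := by
    rw [map_smul, smul_eq_mul, inv_mul_cancel₀ hl0w]
  refine ⟨b, m, c', (l0 w)⁻¹ • w, hb,
    mul_ne_zero (rankOneFactor_ne_zero _ _ _) (pow_ne_zero _ hc), ?_, ?_⟩
  · intro h0
    rw [h0, map_zero] at hx1
    exact zero_ne_one hx1
  · apply LinearMap.ker_eq_bot.1 hker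
    rw [hl0Φ, hx1, map_one, map_smul, hx1, smul_eq_mul]

/-- Over `ℂ((z))`, some power of an injective `p`-difference operator has an eigenvector with
monomial eigenvalue. -/
theorem exists_eigenvector {V : Type*} [AddCommGroup V]
    [Module (LaurentSeries ℂ) V] [FiniteDimensional (LaurentSeries ℂ) V] [Nontrivial V] {p : ℂˣ}
    (hp : 1 < ‖(p : ℂ)‖) {Φ : AddMonoid.End V} (h : IsTwistedLinear (scale p) Φ)
    (hinj : Function.Injective Φ) :
    ∃ (s : ℕ) (n : ℤ) (c : ℂ) (v : V), 0 < s ∧ c ≠ 0 ∧ v ≠ 0 ∧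
      (Φ ^ s) v = (HahnSeries.single n c : LaurentSeries ℂ) • v := by
  induction hn : Module.finrank (LaurentSeries ℂ) V using Nat.strong_induction_on
    generalizing V p with
  | _ N ih =>
    -- Irreducibility is demanded of all powers of Φ. Otherwise induct on a stable subspace with Φ^s
    -- and p^s in place of Φ and p.
    by_cases hred : ∃ (s : ℕ) (_ : 0 < s) (W : Submodule (LaurentSeries ℂ) V),
        (∀ x ∈ W, (Φ ^ s) x ∈ W) ∧ W ≠ ⊥ ∧ W ≠ ⊤
    · obtain ⟨s, hs, W, hW, hbot, htop⟩ := hred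
      have : Nontrivial W := Submodule.nontrivial_iff_ne_bot.2 hbot
      obtain ⟨s', n, c, v, hs', hc, hv, hΦ⟩ := ih (Module.finrank (LaurentSeries ℂ) W)
        (hn ▸ Submodule.finrank_lt htop) (V := W) (one_lt_norm_pow hp hs)
        (Φ := endRestrict (Φ ^ s) W hW)
        (fun g x => Subtype.ext (h.pow_scale s g x))
        (fun x y hxy => Subtype.ext (end_pow_injective hinj s (congrArg Subtype.val hxy)))
        rfl
      refine ⟨s * s', n, c, v, Nat.mul_pos hs hs', hc, fun h0 => hv (Subtype.ext h0), ?_⟩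
      rw [pow_mul, ← coe_endRestrict_pow (Φ ^ s) W hW, hΦ]
      rfl
    · push Not at hred
      obtain ⟨w, hw⟩ := exists_ne (0 : V)
      refine exists_eigenvector_of_irreducible hp h hinj hw fun s hs W hW => ?_
      by_contra! hW'
      exact hW'.2 (hred s hs W hW hW'.1)

theorem end_pow_comm {V : Type*} [AddCommGroup V] {Φ Ψ : AddMonoid.End V}
    (h : ∀ x, Φ (Ψ x) = Ψ (Φ x)) (n : ℕ) (x : V) : (Φ ^ n) (Ψ x) = Ψ ((Φ ^ n) x) := by
  induction n with
  | zero => rfl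
  | succ n ih => rw [end_pow_succ_apply, end_pow_succ_apply, ih, h]

/-! ### Constant eigenvalues from the commuting operator -/

/-- Commutation with a second difference operator forces monomial eigenvalues to be constant. -/
theorem exponent_eq_zero_of_commute {V : Type*} [AddCommGroup V]
    [Module (LaurentSeries ℂ) V] [FiniteDimensional (LaurentSeries ℂ) V] {p q : ℂˣ}
    (hpq : MultIndep p q) {Θ Ψ : AddMonoid.End V}
    (hΘ : IsTwistedLinear (scale p) Θ) (hΨ : IsTwistedLinear (scale q) Ψ)
    (hinj : Function.Injective Ψ) (hcomm : ∀ x, Θ (Ψ x) = Ψ (Θ x)) {n : ℤ} {c : ℂ} (hc : c ≠ 0)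
    {w : V} (hw : w ≠ 0) (hΘw : Θ w = (HahnSeries.single n c : LaurentSeries ℂ) • w) :
    n = 0 := by
  obtain ⟨d, g, hd, hli, hg, hg0⟩ := hΨ.exists_cyclic (scale_surjective q) hinj hw
  have hΘΨ (k : ℕ) : Θ ((Ψ ^ k) w) =
      scale (q ^ k) (HahnSeries.single n c) • (Ψ ^ k) w := by
    rw [← hΨ.pow_scale k, ← hΘw]
    exact (end_pow_comm (fun x => (hcomm x).symm) k w).symm
  -- Θ Ψ^d w computed in two ways: by expanding Ψ^d w first, or by commuting Θ past Ψ^d.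
  have h1 : ∑ i : Fin d, (scale p (g i) * scale (q ^ (i : ℕ)) (HahnSeries.single n c) -
      scale (q ^ d) (HahnSeries.single n c) * g i) • (Ψ ^ (i : ℕ)) w = 0 := by
    have h2 := hΘΨ d
    rw [hg, map_sum, Finset.smul_sum, Finset.sum_range, Finset.sum_range, ← sub_eq_zero,
      ← Finset.sum_sub_distrib] at h2
    rw [← h2]
    refine Finset.sum_congr rfl fun i _ => ?_
    rw [hΘ, hΘΨ, sub_smul, mul_smul, mul_smul]
  have h3 := Fintype.linearIndependent_iff.1 hli _ h1 ⟨0, hd⟩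
  obtain ⟨m, hm⟩ : ∃ m, (g 0).coeff m ≠ 0 := by
    by_contra! h0
    exact hg0 (by ext m; exact h0 m)
  -- At index 0, g₀(z/p) c zⁿ = q^(-dn) c zⁿ g₀(z). A nonzero coefficient of g₀ in degree m gives
  -- p^(-m) = q^(-dn), and d > 0.
  have h4 := congrArg (fun f : LaurentSeries ℂ => f.coeff (m + n)) (sub_eq_zero.1 h3)
  simp only [scale_single, HahnSeries.coeff_mul_single, HahnSeries.coeff_single_mul,
    add_sub_cancel_right, scale_coeff, pow_zero, Units.val_one, one_zpow, one_mul] at h4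
  have h5 : (p : ℂ) ^ (-m) = ((q ^ d : ℂˣ) : ℂ) ^ (-n) := by
    have : ((p : ℂ) ^ (-m) - ((q ^ d : ℂˣ) : ℂ) ^ (-n)) * ((g 0).coeff m * c) = 0 := by
      linear_combination h4
    exact sub_eq_zero.1 ((mul_eq_zero.1 this).resolve_right (mul_ne_zero hm hc))
  have h6 : p ^ (-m) * q ^ ((d : ℤ) * n) = 1 := by
    have : p ^ (-m) = (q ^ d) ^ (-n) := by
      ext
      rw [Units.val_zpow_eq_zpow_val, Units.val_zpow_eq_zpow_val, h5]
    rw [this, ← zpow_natCast, ← zpow_mul, ← zpow_add]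
    simp
  have h7 := ((hpq _ _).1 h6).2
  exact (mul_eq_zero.1 h7).resolve_left (by omega)

theorem MultIndep.pow_left {p q : ℂˣ} (h : MultIndep p q) {s : ℕ} (hs : 0 < s) :
    MultIndep (p ^ s) q := by
  intro n m
  rw [← zpow_natCast, ← zpow_mul, h]
  simp [hs.ne']

theorem exists_constant_eigenvector {V : Type*} [AddCommGroup V]
    [Module (LaurentSeries ℂ) V] [FiniteDimensional (LaurentSeries ℂ) V] [Nontrivial V]
    {p q : ℂˣ} (hp : 1 < ‖(p : ℂ)‖) (hpq : MultIndep p q) {Φ Ψ : AddMonoid.End V}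
    (hΦ : IsTwistedLinear (scale p) Φ) (hΨ : IsTwistedLinear (scale q) Ψ)
    (hΦinj : Function.Injective Φ) (hΨinj : Function.Injective Ψ)
    (hcomm : ∀ x, Φ (Ψ x) = Ψ (Φ x)) :
    ∃ (s : ℕ) (c : ℂ) (v : V), 0 < s ∧ 1 ≤ ‖c‖ ∧ ‖c‖ < ‖((p ^ s : ℂˣ) : ℂ)‖ ∧ v ≠ 0 ∧
      (Φ ^ s) v = (HahnSeries.C c : LaurentSeries ℂ) • v := by
  obtain ⟨s, n, c, w, hs, hc, hw, hΦw⟩ := exists_eigenvector hp hΦ hΦinj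
  have hn := exponent_eq_zero_of_commute (hpq.pow_left hs) (hΦ.pow_scale s) hΨ hΨinj
    (end_pow_comm hcomm s) hc hw hΦw
  subst hn
  have hP := one_lt_norm_pow hp hs
  -- Replacing w by z^k w multiplies the eigenvalue by p^(-sk); this k brings its modulus into the
  -- fundamental interval.
  obtain ⟨k, hk1, hk2⟩ := exists_mem_Ico_zpow (norm_pos_iff.2 hc) hP
  have hPk : 0 < ‖((p ^ s : ℂˣ) : ℂ)‖ ^ k := zpow_pos (by linarith) k
  refine ⟨s, ((p ^ s : ℂˣ) : ℂ) ^ (-k) * c, (HahnSeries.single k 1 : LaurentSeries ℂ) • w, hs,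
    ?_, ?_, ?_, ?_⟩
  · rw [norm_mul, norm_zpow, zpow_neg, ← div_eq_inv_mul, one_le_div hPk]
    exact hk1
  · rw [norm_mul, norm_zpow, zpow_neg, ← div_eq_inv_mul, div_lt_iff₀ hPk, mul_comm,
      ← zpow_add_one₀ (by linarith)]
    exact hk2
  · exact smul_ne_zero (HahnSeries.single_ne_zero one_ne_zero) hw
  · rw [hΦ.pow_scale s, hΦw, smul_smul, smul_smul, scale_single, HahnSeries.C_apply,
      HahnSeries.single_mul_single, HahnSeries.single_mul_single, mul_one, mul_one, zero_add,
      add_zero]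

/-! ### Extensions and a constant basis for a power -/

/-- Coefficientwise solution of the equation `U(z) + c Y(z/p) = A Y(z) + N` with `N` constant. -/
theorem exists_solution_mod_constants {κ : Type*} [Fintype κ] [DecidableEq κ] {p : ℂˣ}
    (hp : 1 < ‖(p : ℂ)‖) {A : Matrix κ κ ℂ} (hA : SpectrumRestricted p A) {c : ℂ}
    (hc1 : 1 ≤ ‖c‖) (hc2 : ‖c‖ < ‖(p : ℂ)‖) (U : κ → LaurentSeries ℂ) :
    ∃ (Y : κ → LaurentSeries ℂ) (N : κ → ℂ), ∀ i,
      U i + HahnSeries.C c * scale p (Y i) =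
        ∑ j, HahnSeries.C (A i j) * Y j + HahnSeries.C (N i) := by
  let M : ℤ → Matrix κ κ ℂ := fun m => A - algebraMap ℂ _ ((p : ℂ) ^ (-m) * c)
  have hM (m : ℤ) (hm : m ≠ 0) : IsUnit (M m) := by
    by_contra hu
    have hmem : (p : ℂ) ^ (-m) * c ∈ spectrum ℂ A := by
      rw [spectrum.mem_iff, ← IsUnit.neg_iff, neg_sub]
      exact hu
    have h1 := hA _ hmem
    refine hm (neg_eq_zero.1 (zpow_exponent_eq_zero_of_mem_annulus hp h1.1 h1.2 hc1 hc2 ?_))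
    rw [norm_mul, norm_zpow]
  -- Only degree 0 can be resonant. There Y is set to 0 and the constant term of U is absorbed by N.
  let y : ℤ → κ → ℂ := fun m =>
    if m = 0 then 0 else (M m)⁻¹.mulVec fun j => (U j).coeff m
  have hy (m : ℤ) (hm : m ≠ 0) : (M m).mulVec (y m) = fun j => (U j).coeff m := by
    simp only [y, if_neg hm]
    rw [Matrix.mulVec_mulVec, Matrix.mul_nonsing_inv _ ((Matrix.isUnit_iff_isUnit_det _).1 (hM m hm)),
      Matrix.one_mulVec]
  have hPWO : (⋃ j, (U j).support).IsPWO := by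
    have := (Finset.isPWO_bUnion (s := Finset.univ) (f := fun j => (U j).support)).2
      fun j _ => (U j).isPWO_support
    simpa using this
  let Y : κ → LaurentSeries ℂ := fun i =>
    { coeff := fun m => y m i
      isPWO_support' := hPWO.mono fun m hm => by
        by_contra hU
        refine hm ?_
        have h0 : (fun j => (U j).coeff m) = 0 := by
          ext j
          by_contra hj
          exact hU (Set.mem_iUnion.2 ⟨j, hj⟩)
        simp only [y, h0, Matrix.mulVec_zero, ite_self, Pi.zero_apply] }
  refine ⟨Y, fun i => (U i).coeff 0, fun i => ?_⟩
  ext m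
  simp only [HahnSeries.coeff_add, HahnSeries.coeff_sum, coeff_C_mul, scale_coeff]
  have hYc (j : κ) : (Y j).coeff m = y m j := rfl
  simp only [hYc]
  by_cases hm : m = 0
  · simp [hm, y, HahnSeries.C_apply]
  · have h1 := congrFun (hy m hm) i
    simp only [M, Matrix.sub_mulVec, Pi.sub_apply, Algebra.algebraMap_eq_smul_one,
      Matrix.smul_mulVec, Matrix.one_mulVec, Pi.smul_apply, smul_eq_mul] at h1
    rw [Matrix.mulVec, dotProduct] at h1
    rw [← h1, HahnSeries.C_apply, HahnSeries.coeff_single_of_ne hm]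
    ring

theorem SpectrumRestricted.fromBlocks {m n : Type*} [Fintype m] [DecidableEq m] [Fintype n]
    [DecidableEq n] {p : ℂˣ} {A : Matrix m m ℂ} {D : Matrix n n ℂ} (hA : SpectrumRestricted p A)
    (hD : SpectrumRestricted p D) (C : Matrix n m ℂ) :
    SpectrumRestricted p (Matrix.fromBlocks A 0 C D) := by
  intro x hx
  have e : algebraMap ℂ (Matrix (m ⊕ n) (m ⊕ n) ℂ) x - Matrix.fromBlocks A 0 C D =
      Matrix.fromBlocks (algebraMap ℂ _ x - A) 0 (-C) (algebraMap ℂ _ x - D) := by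
    ext i j
    rcases i with i | i <;> rcases j with j | j <;> simp [Matrix.algebraMap_matrix_apply]
  by_contra hx'
  have h1 : x ∉ spectrum ℂ A := fun h => hx' (hA x h)
  have h2 : x ∉ spectrum ℂ D := fun h => hx' (hD x h)
  rw [spectrum.notMem_iff] at h1 h2
  rw [spectrum.mem_iff, e, Matrix.isUnit_fromBlocks_zero₁₂] at hx
  exact hx ⟨h1, h2⟩

theorem SpectrumRestricted.algebraMap {m : Type*} [Fintype m] [DecidableEq m] {p : ℂˣ} {c : ℂ}
    (hc1 : 1 ≤ ‖c‖) (hc2 : ‖c‖ < ‖(p : ℂ)‖) :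
    SpectrumRestricted p (algebraMap ℂ (Matrix m m ℂ) c) := by
  intro x hx
  have : x = c := by
    by_contra hne
    rw [spectrum.mem_iff, ← map_sub] at hx
    exact hx ((IsUnit.mk0 _ (sub_ne_zero.2 hne)).map _)
  rw [this]
  exact ⟨hc1, hc2⟩

/-- A basis of a subspace together with any lift of a basis of the quotient is a basis. -/
theorem exists_basis_of_lift {K V m n : Type*} [Field K] [AddCommGroup V] [Module K V]
    {W : Submodule K V} (bW : Module.Basis m K W) (bQ : Module.Basis n K (V ⧸ W)) (f : n → V)
    (hf : ∀ j, (Submodule.Quotient.mk (f j) : V ⧸ W) = bQ j) :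
    ∃ b : Module.Basis (m ⊕ n) K V, (∀ i, b (Sum.inl i) = bW i) ∧ ∀ j, b (Sum.inr j) = f j := by
  let b : m ⊕ n → V := Sum.elim (fun i => (bW i : V)) f
  have hf' : W.mkQ ∘ f = bQ := funext hf
  have hli : LinearIndependent K b := by
    apply LinearIndependent.sumElim_of_quotient (f := fun i => bW i)
    · exact bW.linearIndependent
    · have h := bQ.linearIndependent
      rw [← hf'] at h
      exact h
  have hW : W ≤ Submodule.span K (Set.range b) := by
    intro x hx
    have h1 : (⟨x, hx⟩ : W) ∈ Submodule.span K (Set.range bW) := by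
      rw [bW.span_eq]
      exact Submodule.mem_top
    have h2 := Submodule.mem_map_of_mem (f := W.subtype) h1
    rw [Submodule.map_span] at h2
    refine Submodule.span_mono ?_ h2
    rintro _ ⟨_, ⟨i, rfl⟩, rfl⟩
    exact ⟨Sum.inl i, rfl⟩
  have hspan : ⊤ ≤ Submodule.span K (Set.range b) := by
    intro x _
    have h1 : W.mkQ x ∈ Submodule.span K (Set.range bQ) := by
      rw [bQ.span_eq]
      exact Submodule.mem_top
    rw [← hf', Set.range_comp, ← Submodule.map_span] at h1
    obtain ⟨y, hy, hyx⟩ := h1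
    have h2 : x - y ∈ W := by
      rw [← Submodule.Quotient.mk_eq_zero, Submodule.Quotient.mk_sub, sub_eq_zero]
      exact hyx.symm
    have h3 : y ∈ Submodule.span K (Set.range b) := by
      refine Submodule.span_mono ?_ hy
      rintro _ ⟨j, rfl⟩
      exact ⟨Sum.inr j, rfl⟩
    have := Submodule.add_mem _ (hW h2) h3
    rwa [sub_add_cancel] at this
  exact ⟨Module.Basis.mk hli hspan, fun i => by simp [b], fun j => by simp [b]⟩

/-- The endomorphism induced on the quotient by a stable subspace. -/
def endQuotient {K V : Type*} [Field K] [AddCommGroup V] [Module K V] (Φ : AddMonoid.End V)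
    (W : Submodule K V) (h : ∀ x ∈ W, Φ x ∈ W) : AddMonoid.End (V ⧸ W) :=
  QuotientAddGroup.map W.toAddSubgroup W.toAddSubgroup Φ h

theorem endQuotient_mk {K V : Type*} [Field K] [AddCommGroup V] [Module K V]
    (Φ : AddMonoid.End V) (W : Submodule K V) (h : ∀ x ∈ W, Φ x ∈ W) (x : V) :
    endQuotient Φ W h (Submodule.Quotient.mk x) = Submodule.Quotient.mk (Φ x) := rfl

theorem endQuotient_pow_mk {K V : Type*} [Field K] [AddCommGroup V] [Module K V]
    (Φ : AddMonoid.End V) (W : Submodule K V) (h : ∀ x ∈ W, Φ x ∈ W) (n : ℕ) (x : V) :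
    (endQuotient Φ W h ^ n) (Submodule.Quotient.mk x) = Submodule.Quotient.mk ((Φ ^ n) x) := by
  induction n with
  | zero => rfl
  | succ n ih => rw [end_pow_succ_apply, end_pow_succ_apply, ih, endQuotient_mk]

theorem endQuotient_injective {K V : Type*} [Field K] [AddCommGroup V] [Module K V]
    [FiniteDimensional K V] {σ : K →+* K} (hσ : Function.Surjective σ) {Φ : AddMonoid.End V}
    (hΦ : IsTwistedLinear σ Φ) (hinj : Function.Injective Φ) {W : Submodule K V}
    (h : ∀ x ∈ W, Φ x ∈ W) : Function.Injective (endQuotient Φ W h) := by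
  refine (injective_iff_map_eq_zero _).2 fun x hx => ?_
  obtain ⟨x, rfl⟩ := Submodule.Quotient.mk_surjective W x
  rw [endQuotient_mk, Submodule.Quotient.mk_eq_zero] at hx
  rw [Submodule.Quotient.mk_eq_zero]
  exact hΦ.mem_of_map_mem hσ hinj h hx

theorem IsTwistedLinear.endQuotient {K V : Type*} [Field K] [AddCommGroup V] [Module K V]
    {σ : K →+* K} {Φ : AddMonoid.End V} (hΦ : IsTwistedLinear σ Φ) {W : Submodule K V}
    (h : ∀ x ∈ W, Φ x ∈ W) : IsTwistedLinear σ (endQuotient Φ W h) := by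
  intro g x
  obtain ⟨x, rfl⟩ := Submodule.Quotient.mk_surjective W x
  rw [← Submodule.Quotient.mk_smul, endQuotient_mk, endQuotient_mk, hΦ,
    Submodule.Quotient.mk_smul]

theorem end_pow_constant_smul {V : Type*} [AddCommGroup V] [Module (LaurentSeries ℂ) V]
    {p : ℂˣ} {Φ : AddMonoid.End V} (h : IsTwistedLinear (scale p) Φ) {c : ℂ} {x : V}
    (hx : Φ x = (HahnSeries.C c : LaurentSeries ℂ) • x) (n : ℕ) :
    (Φ ^ n) x = (HahnSeries.C (c ^ n) : LaurentSeries ℂ) • x := by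
  induction n with
  | zero =>
    rw [pow_zero, pow_zero, map_one, one_smul]
    rfl
  | succ n ih => rw [end_pow_succ_apply, ih, h, hx, scale_C, smul_smul, ← map_mul, ← pow_succ]

/-- Extension step: a constant restricted form on the quotient lifts across a stable subspace on
which the operator is a restricted constant. -/
theorem exists_constant_basis_of_extension {V m n : Type*} [AddCommGroup V]
    [Module (LaurentSeries ℂ) V] [Fintype m] [DecidableEq m] [Fintype n] [DecidableEq n] {p : ℂˣ}
    (hp : 1 < ‖(p : ℂ)‖) {Φ : AddMonoid.End V} (hΦ : IsTwistedLinear (scale p) Φ)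
    {W : Submodule (LaurentSeries ℂ) V} (bW : Module.Basis m (LaurentSeries ℂ) W) {c : ℂ}
    (hc1 : 1 ≤ ‖c‖) (hc2 : ‖c‖ < ‖(p : ℂ)‖)
    (hbW : ∀ i, Φ (bW i : V) = (HahnSeries.C c : LaurentSeries ℂ) • (bW i : V))
    (bQ : Module.Basis n (LaurentSeries ℂ) (V ⧸ W)) (f : n → V)
    (hf : ∀ j, (Submodule.Quotient.mk (f j) : V ⧸ W) = bQ j) {A : Matrix n n ℂ}
    (hA : SpectrumRestricted p A)
    (hfΦ : ∀ i, Φ (f i) - ∑ j, (HahnSeries.C (A i j) : LaurentSeries ℂ) • f j ∈ W) :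
    ∃ (e : Module.Basis (m ⊕ n) (LaurentSeries ℂ) V) (A' : Matrix (m ⊕ n) (m ⊕ n) ℂ),
      SpectrumRestricted p A' ∧
      ∀ i, Φ (e i) = ∑ j, (HahnSeries.C (A' i j) : LaurentSeries ℂ) • e j := by
  let U : n → m → LaurentSeries ℂ := fun i k => bW.repr ⟨_, hfΦ i⟩ k
  have hU (i : n) : Φ (f i) =
      ∑ j, (HahnSeries.C (A i j) : LaurentSeries ℂ) • f j + ∑ k, U i k • (bW k : V) := by
    have h1 := congrArg (fun x : W => (x : V)) (bW.sum_repr ⟨_, hfΦ i⟩)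
    simp only [Submodule.coe_sum, Submodule.coe_smul] at h1
    rw [h1]
    abel
  -- Adding ∑ Y k i • bW k to f i changes the off-diagonal block from U to U + c Y(z/p) - A Y, which
  -- is the constant N.
  choose Y N hYN using fun k => exists_solution_mod_constants hp hA hc1 hc2 fun i => U i k
  let f' : n → V := fun i => f i + ∑ k, Y k i • (bW k : V)
  have hf' (j : n) : (Submodule.Quotient.mk (f' j) : V ⧸ W) = bQ j := by
    rw [← hf, Submodule.Quotient.eq]
    have : f' j - f j = ∑ k, Y k j • (bW k : V) := add_sub_cancel_left _ _
    rw [this]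
    exact Submodule.sum_mem _ fun k _ => Submodule.smul_mem _ _ (bW k).2
  obtain ⟨e, he1, he2⟩ := exists_basis_of_lift bW bQ f' hf'
  refine ⟨e, Matrix.fromBlocks (algebraMap ℂ _ c) 0 (Matrix.of fun i k => N k i) A,
    (SpectrumRestricted.algebraMap hc1 hc2).fromBlocks hA _, ?_⟩
  rintro (i | i)
  · rw [Fintype.sum_sum_type, he1, hbW]
    simp only [Matrix.fromBlocks_apply₁₁, Matrix.fromBlocks_apply₁₂, Matrix.zero_apply, map_zero,
      zero_smul, Finset.sum_const_zero, add_zero, he1, Matrix.algebraMap_matrix_apply]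
    rw [Finset.sum_eq_single i]
    · simp
    · intro j _ hj
      simp [Ne.symm hj]
    · simp
  · rw [Fintype.sum_sum_type, he2]
    simp only [Matrix.fromBlocks_apply₂₁, Matrix.fromBlocks_apply₂₂, Matrix.of_apply, he1, he2]
    have h1 (k : m) : Φ (Y k i • (bW k : V)) =
        ((∑ j, HahnSeries.C (A i j) * Y k j + HahnSeries.C (N k i)) - U i k) • (bW k : V) := by
      rw [← hYN k i, hΦ, hbW, smul_smul, add_sub_cancel_left, mul_comm]
    simp only [f', map_add, map_sum, h1, hU, sub_smul, add_smul, Finset.sum_smul, smul_add,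
      Finset.smul_sum, smul_smul, Finset.sum_add_distrib, Finset.sum_sub_distrib]
    rw [Finset.sum_comm (s := (Finset.univ : Finset n))]
    abel

/-- Some power of `Φ` is constant and restricted in a suitable basis. -/
theorem exists_constant_basis {V : Type*} [AddCommGroup V]
    [Module (LaurentSeries ℂ) V] [FiniteDimensional (LaurentSeries ℂ) V]
    {p q : ℂˣ} (hp : 1 < ‖(p : ℂ)‖) (hpq : MultIndep p q) {Φ Ψ : AddMonoid.End V}
    (hΦ : IsTwistedLinear (scale p) Φ) (hΨ : IsTwistedLinear (scale q) Ψ)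
    (hΦinj : Function.Injective Φ) (hΨinj : Function.Injective Ψ)
    (hcomm : ∀ x, Φ (Ψ x) = Ψ (Φ x)) :
    ∃ (s : ℕ) (_ : 0 < s) (ι : Type) (_ : Fintype ι) (_ : DecidableEq ι)
      (e : Module.Basis ι (LaurentSeries ℂ) V) (A : Matrix ι ι ℂ),
      SpectrumRestricted (p ^ s) A ∧
      ∀ i, (Φ ^ s) (e i) = ∑ j, (HahnSeries.C (A i j) : LaurentSeries ℂ) • e j := by
  induction hn : Module.finrank (LaurentSeries ℂ) V using Nat.strong_induction_on
    generalizing V p with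
  | _ N ih =>
    rcases subsingleton_or_nontrivial V with hV | hV
    · refine ⟨1, one_pos, Fin 0, inferInstance, inferInstance, Module.Basis.empty V, 0, ?_, ?_⟩
      · intro c hc
        exact absurd (isUnit_of_subsingleton _) hc
      · exact fun i => i.elim0
    obtain ⟨s, c, w, hs, hc1, hc2, hw, hΦw⟩ :=
      exists_constant_eigenvector hp hpq hΦ hΨ hΦinj hΨinj hcomm
    have hΘ := hΦ.pow_scale s
    have hΘinj := end_pow_injective hΦinj s
    have hΘcomm := end_pow_comm hcomm s
    have hP := one_lt_norm_pow hp hs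
    obtain ⟨d, g, hd, hli, hg, -⟩ := hΨ.exists_cyclic (scale_surjective q) hΨinj hw
    have hΘΨ (k : ℕ) : (Φ ^ s) ((Ψ ^ k) w) = (HahnSeries.C c : LaurentSeries ℂ) • (Ψ ^ k) w := by
      rw [← end_pow_comm (fun x => (hΘcomm x).symm) k w, hΦw, hΨ.pow_scale, scale_C]
    -- The line through w need not be Ψ-stable, and the induction needs Ψ on the quotient. The
    -- Ψ-cyclic span is stable under both operators, and Φ^s still acts by c on its basis since Ψ
    -- fixes constants.
    let W := Submodule.span (LaurentSeries ℂ) (Set.range fun i : Fin d => (Ψ ^ (i : ℕ)) w)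
    have hWΨ : ∀ x ∈ W, Ψ x ∈ W := fun x hx => hΨ.cyclic_span_stable hg hx
    have hWΘ : ∀ x ∈ W, (Φ ^ s) x ∈ W := fun x hx => by
      refine hΘ.map_mem_span ?_ hx
      rintro _ ⟨i, rfl⟩
      dsimp only
      rw [hΘΨ]
      exact Submodule.smul_mem _ _ (Submodule.subset_span ⟨i, rfl⟩)
    have hwW : w ∈ W := Submodule.subset_span ⟨⟨0, hd⟩, rfl⟩
    have hWbot : W ≠ ⊥ := fun h0 => hw ((Submodule.mem_bot _).1 (h0 ▸ hwW))
    have hlt : Module.finrank (LaurentSeries ℂ) (V ⧸ W) < N := by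
      have h1 := Submodule.finrank_quotient_add_finrank W
      have h2 : 0 < Module.finrank (LaurentSeries ℂ) W := by
        rw [Nat.pos_iff_ne_zero]
        exact fun h0 => hWbot (Submodule.finrank_eq_zero.1 h0)
      omega
    obtain ⟨s', hs', ι, _, _, bQ, A, hA, hbQ⟩ := ih _ hlt hP (hpq.pow_left hs)
      (hΘ.endQuotient hWΘ) (hΨ.endQuotient hWΨ)
      (endQuotient_injective (scale_surjective _) hΘ hΘinj hWΘ)
      (endQuotient_injective (scale_surjective _) hΨ hΨinj hWΨ)
      (fun x => by
        obtain ⟨x, rfl⟩ := Submodule.Quotient.mk_surjective W x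
        rw [endQuotient_mk, endQuotient_mk, endQuotient_mk, endQuotient_mk, hΘcomm]) rfl
    choose f hf using fun j => Submodule.Quotient.mk_surjective W (bQ j)
    obtain ⟨e, A', hA', he⟩ := exists_constant_basis_of_extension (one_lt_norm_pow hP hs')
      (hΘ.pow_scale s') (Module.Basis.span hli) (c := c ^ s')
      (by rw [norm_pow]; exact one_le_pow₀ hc1)
      (by
        rw [norm_pow, Units.val_pow_eq_pow_val, norm_pow]
        exact pow_lt_pow_left₀ hc2 (norm_nonneg _) hs'.ne')
      (fun i => by
        rw [Module.Basis.span_apply]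
        exact end_pow_constant_smul hΘ (hΘΨ i) s') bQ f hf hA
      (fun i => by
        rw [← Submodule.Quotient.mk_eq_zero, Submodule.Quotient.mk_sub, sub_eq_zero,
          ← endQuotient_pow_mk (Φ ^ s) W hWΘ, hf, hbQ]
        simp only [← hf]
        exact (map_sum W.mkQ _ _).symm)
    refine ⟨s * s', Nat.mul_pos hs hs', Fin d ⊕ ι, inferInstance, inferInstance, e, A', ?_, ?_⟩
    · rw [pow_mul]
      exact hA'
    · rw [pow_mul]
      exact he

/-! ### Constant matrices and uniqueness -/

theorem mapGL_C_injective {r : ℕ} : Function.Injective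
    (Matrix.GeneralLinearGroup.map (n := Fin r) (HahnSeries.C : ℂ →+* LaurentSeries ℂ)) := by
  intro A B h
  ext i j
  have h1 := congrArg (fun M : GL (Fin r) (LaurentSeries ℂ) =>
    (M : Matrix (Fin r) (Fin r) (LaurentSeries ℂ)) i j) h
  exact HahnSeries.C_injective h1

theorem mapGL_scale_mapGL_C {r : ℕ} (p : ℂˣ) (A : GL (Fin r) ℂ) :
    Matrix.GeneralLinearGroup.map (scale p) (Matrix.GeneralLinearGroup.map HahnSeries.C A) =
      Matrix.GeneralLinearGroup.map HahnSeries.C A := by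
  ext i j : 2
  exact scale_C p _

theorem mapGL_scale_comm {r : ℕ} (p q : ℂˣ) (A : GL (Fin r) (LaurentSeries ℂ)) :
    Matrix.GeneralLinearGroup.map (scale p) (Matrix.GeneralLinearGroup.map (scale q) A) =
      Matrix.GeneralLinearGroup.map (scale q) (Matrix.GeneralLinearGroup.map (scale p) A) := by
  ext i j : 2
  exact scale_comm p q _

theorem exists_GL_of_constant {r : ℕ} {A : GL (Fin r) (LaurentSeries ℂ)}
    {X : Matrix (Fin r) (Fin r) ℂ}
    (h : (A : Matrix (Fin r) (Fin r) (LaurentSeries ℂ)) = X.map HahnSeries.C) :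
    ∃ A₀ : GL (Fin r) ℂ, (A₀ : Matrix (Fin r) (Fin r) ℂ) = X ∧
      Matrix.GeneralLinearGroup.map HahnSeries.C A₀ = A := by
  have hdet : X.det ≠ 0 := by
    intro h0
    have h1 : (A : Matrix (Fin r) (Fin r) (LaurentSeries ℂ)).det = 0 := by
      have h2 := RingHom.map_det (HahnSeries.C : ℂ →+* LaurentSeries ℂ) X
      rw [h0, map_zero] at h2
      rw [h]
      exact h2.symm
    exact ((Matrix.isUnit_iff_isUnit_det _).1 A.isUnit).ne_zero h1
  refine ⟨Matrix.GeneralLinearGroup.mkOfDetNeZero X hdet, rfl, ?_⟩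
  exact Units.ext h.symm

/-- Gauge equivalences between restricted constant pairs are conjugations. -/
theorem exists_conj_of_gaugeBy {r : ℕ} {p q : ℂˣ} (hp : 1 < ‖(p : ℂ)‖) {x₀ x₁ : ScalarPair r}
    (h₀ : IsRestricted p x₀.A) (h₁ : IsRestricted p x₁.A) {C : GL (Fin r) (LaurentSeries ℂ)}
    (h : (x₀.toFormal p q).GaugeBy C (x₁.toFormal p q)) :
    ∃ D : GL (Fin r) ℂ, x₁.A = D⁻¹ * x₀.A * D ∧ x₁.B = D⁻¹ * x₀.B * D := by
  obtain ⟨hA, hB⟩ := h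
  simp only [ConsistentPair.map] at hA hB
  have h1 : Matrix.GeneralLinearGroup.map (scale p) C *
      Matrix.GeneralLinearGroup.map HahnSeries.C x₁.A =
        Matrix.GeneralLinearGroup.map HahnSeries.C x₀.A * C := by
    rw [hA]
    group
  obtain ⟨D, -, rfl⟩ := exists_GL_of_constant (eq_map_C_of_intertwines hp
    ((isRestricted_iff _ _).1 h₀) ((isRestricted_iff _ _).1 h₁) (congrArg Units.val h1))
  refine ⟨D, mapGL_C_injective ?_, mapGL_C_injective ?_⟩
  · rw [hA, mapGL_scale_mapGL_C]
    simp only [map_mul, map_inv]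
  · rw [hB, mapGL_scale_mapGL_C]
    simp only [map_mul, map_inv]

/-! ### Consistent pairs as commuting operators -/

/-- The difference operator on row vectors attached to a matrix. -/
def rowOperator {K : Type*} [Field K] {r : ℕ} (σ : K →+* K) (A : Matrix (Fin r) (Fin r) K) :
    AddMonoid.End (Fin r → K) where
  toFun e := Matrix.vecMul (σ ∘ e) A
  map_zero' := by
    have : (σ ∘ (0 : Fin r → K)) = 0 := by
      ext i
      simp
    rw [this, Matrix.zero_vecMul]
  map_add' e f := by
    have : (σ ∘ (e + f)) = σ ∘ e + σ ∘ f := by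
      ext i
      simp
    rw [this, Matrix.add_vecMul]

section RowOperator

variable {K : Type*} [Field K] {r : ℕ}

theorem rowOperator_apply (σ : K →+* K) (A : Matrix (Fin r) (Fin r) K) (e : Fin r → K) :
    rowOperator σ A e = Matrix.vecMul (σ ∘ e) A := rfl

theorem rowOperator_isTwistedLinear (σ : K →+* K) (A : Matrix (Fin r) (Fin r) K) :
    IsTwistedLinear σ (rowOperator σ A) := by
  intro g v
  have : σ ∘ (g • v) = σ g • (σ ∘ v) := by
    ext i
    simp
  rw [rowOperator_apply, rowOperator_apply, this, Matrix.smul_vecMul]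

theorem rowOperator_injective (σ : K →+* K) (A : GL (Fin r) K) :
    Function.Injective (rowOperator σ (A : Matrix (Fin r) (Fin r) K)) := by
  refine (injective_iff_map_eq_zero _).2 fun x hx => ?_
  have h1 := congrArg
    (fun v => Matrix.vecMul v ((A⁻¹ : GL (Fin r) K) : Matrix (Fin r) (Fin r) K)) hx
  simp only [rowOperator_apply, Matrix.vecMul_vecMul, Matrix.zero_vecMul, ← Units.val_mul,
    mul_inv_cancel, Units.val_one, Matrix.vecMul_one] at h1
  ext i
  have h2 := congrFun h1 i
  simpa using h2

theorem rowOperator_comm {σ τ : K →+* K} (hστ : ∀ x, σ (τ x) = τ (σ x))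
    {A B : Matrix (Fin r) (Fin r) K} (h : B.map σ * A = A.map τ * B) (e : Fin r → K) :
    rowOperator σ A (rowOperator τ B e) = rowOperator τ B (rowOperator σ A e) := by
  have h1 (ρ : K →+* K) (v : Fin r → K) (M : Matrix (Fin r) (Fin r) K) :
      ρ ∘ Matrix.vecMul v M = Matrix.vecMul (ρ ∘ v) (M.map ρ) := by
    ext i
    simp [Matrix.vecMul, dotProduct]
  have h2 : σ ∘ τ ∘ e = τ ∘ σ ∘ e := funext fun i => hστ _
  simp only [rowOperator_apply, h1, Matrix.vecMul_vecMul, h, h2]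

theorem rowOperator_row (σ : K →+* K) (A D : Matrix (Fin r) (Fin r) K) (i : Fin r) :
    rowOperator σ A (D i) = (D.map σ * A) i := rfl

end RowOperator

theorem matrix_eq_of_sum_smul_eq {K V ι : Type*} [Field K] [AddCommGroup V] [Module K V]
    [Fintype ι] (e : Module.Basis ι K V) {M N : Matrix ι ι K}
    (h : ∀ i, ∑ j, M i j • e j = ∑ j, N i j • e j) : M = N := by
  ext i j
  have h1 := congrArg e.repr (h i)
  exact congrFun ((e.repr_sum_self (M i)).symm.trans
    ((congrArg DFunLike.coe h1).trans (e.repr_sum_self (N i)))) j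

/-- The matrix identity expressing that two twisted-linear maps commute. -/
theorem IsTwistedLinear.matrix_comm {K V ι : Type*} [Field K] [AddCommGroup V] [Module K V]
    [Fintype ι] {σ τ : K →+* K} {Φ Ψ : AddMonoid.End V} (hΦ : IsTwistedLinear σ Φ)
    (hΨ : IsTwistedLinear τ Ψ) (hcomm : ∀ x, Φ (Ψ x) = Ψ (Φ x)) (e : Module.Basis ι K V)
    {M N : Matrix ι ι K} (hM : ∀ i, Φ (e i) = ∑ j, M i j • e j)
    (hN : ∀ i, Ψ (e i) = ∑ j, N i j • e j) : N.map σ * M = M.map τ * N := by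
  refine matrix_eq_of_sum_smul_eq e fun i => ?_
  have h1 := hcomm (e i)
  rw [hM, hN] at h1
  simp only [map_sum, hΦ _ _, hΨ _ _, hM, hN, Finset.smul_sum, smul_smul] at h1
  simp only [Matrix.mul_apply, Matrix.map_apply, Finset.sum_smul]
  exact (Finset.sum_comm.trans h1).trans Finset.sum_comm

/-- Eigenvalues of A have their s-th powers in the spectrum of A^s, and both bounds survive taking
s-th roots of moduli. -/
theorem SpectrumRestricted.of_pow {ι : Type*} [Fintype ι] [DecidableEq ι] {p : ℂˣ} {s : ℕ}
    (hs : 0 < s) {A : Matrix ι ι ℂ} (h : SpectrumRestricted (p ^ s) (A ^ s)) :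
    SpectrumRestricted p A := by
  intro c hc
  have h1 := h _ (spectrum.pow_mem_pow A s hc)
  rw [norm_pow, Units.val_pow_eq_pow_val, norm_pow] at h1
  exact ⟨(one_le_pow_iff_of_nonneg (norm_nonneg _) hs.ne').1 h1.1,
    lt_of_pow_lt_pow_left₀ s (norm_nonneg _) h1.2⟩

theorem end_pow_basis_constant {V ι : Type*} [AddCommGroup V] [Module (LaurentSeries ℂ) V]
    [Fintype ι] [DecidableEq ι] {p : ℂˣ} {Φ : AddMonoid.End V} (h : IsTwistedLinear (scale p) Φ)
    {e : ι → V} {A : Matrix ι ι ℂ}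
    (he : ∀ i, Φ (e i) = ∑ j, (HahnSeries.C (A i j) : LaurentSeries ℂ) • e j) (n : ℕ) (i : ι) :
    (Φ ^ n) (e i) = ∑ j, (HahnSeries.C ((A ^ n) i j) : LaurentSeries ℂ) • e j := by
  induction n with
  | zero =>
    rw [pow_zero, pow_zero, Finset.sum_eq_single i]
    · rw [Matrix.one_apply_eq, map_one, one_smul]
      rfl
    · intro j _ hj
      rw [Matrix.one_apply_ne (Ne.symm hj), map_zero, zero_smul]
    · simp
  | succ n ih =>
    rw [end_pow_succ_apply, ih, map_sum]
    simp only [h _ _, scale_C, he, Finset.smul_sum, smul_smul, ← map_mul]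
    rw [Finset.sum_comm]
    simp only [pow_succ, Matrix.mul_apply, map_sum, Finset.sum_smul]

/-! ### Reduction to constants and the bijection -/

/-- Every formal consistent pair is gauge equivalent to a restricted constant pair. -/
theorem FormalPair.exists_gaugeBy_toFormal {r : ℕ} {p q : ℂˣ} (hp : 1 < ‖(p : ℂ)‖)
    (hpq : MultIndep p q) (x : FormalPair r p q) :
    ∃ x₀ : ScalarPair r, IsRestricted p x₀.A ∧
      ∃ C : GL (Fin r) (LaurentSeries ℂ), x.GaugeBy C (x₀.toFormal p q) := by
  let Φ := rowOperator (scale p) (x.A : Matrix (Fin r) (Fin r) (LaurentSeries ℂ))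
  let Ψ := rowOperator (scale q) (x.B : Matrix (Fin r) (Fin r) (LaurentSeries ℂ))
  have hΦ : IsTwistedLinear (scale p) Φ := rowOperator_isTwistedLinear _ _
  have hΨ : IsTwistedLinear (scale q) Ψ := rowOperator_isTwistedLinear _ _
  have hcomm : ∀ v, Φ (Ψ v) = Ψ (Φ v) :=
    rowOperator_comm (scale_comm p q) (congrArg Units.val x.consistent)
  obtain ⟨s, hs, ι, _, _, e', A', hA', he'⟩ := exists_constant_basis hp hpq hΦ hΨ
    (rowOperator_injective _ _) (rowOperator_injective _ _) hcomm
  have hcard : Fintype.card ι = Fintype.card (Fin r) := by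
    rw [← Module.finrank_eq_card_basis e',
      ← Module.finrank_eq_card_basis (Pi.basisFun (LaurentSeries ℂ) (Fin r))]
  let u := Fintype.equivOfCardEq hcard
  let e := e'.reindex u
  let S : Matrix (Fin r) (Fin r) ℂ := A'.submatrix u.symm u.symm
  have hS : SpectrumRestricted (p ^ s) S := by
    have h1 : spectrum ℂ S = spectrum ℂ A' :=
      AlgEquiv.spectrum_eq (Matrix.reindexAlgEquiv ℂ ℂ u) A'
    intro c hc
    exact hA' c (h1 ▸ hc)
  have he (i : Fin r) : (Φ ^ s) (e i) =
      ∑ j, (HahnSeries.C (S i j) : LaurentSeries ℂ) • e j := by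
    simp only [e, Module.Basis.reindex_apply, he', S, Matrix.submatrix_apply]
    exact (Equiv.sum_comp u.symm
      (fun j => (HahnSeries.C (A' (u.symm i) j) : LaurentSeries ℂ) • e' j)).symm
  let D : Matrix (Fin r) (Fin r) (LaurentSeries ℂ) := Matrix.of fun i => e i
  have hD : IsUnit D := Matrix.linearIndependent_rows_iff_isUnit.1 e.linearIndependent
  obtain ⟨G, hG⟩ := hD
  -- An operator commuting with Φ commutes with Φ^s, so its matrix X in the basis e satisfies
  -- X(z/p^s) S = S X, and rigidity makes X constant. This serves both Φ itself and Ψ.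
  have hconst (t : ℂˣ) (M : GL (Fin r) (LaurentSeries ℂ))
      (hMΦ : ∀ v, Φ (rowOperator (scale t) (M : Matrix (Fin r) (Fin r) (LaurentSeries ℂ)) v) =
        rowOperator (scale t) (M : Matrix (Fin r) (Fin r) (LaurentSeries ℂ)) (Φ v)) :
      ∃ M₀ : GL (Fin r) ℂ, Matrix.GeneralLinearGroup.map HahnSeries.C M₀ =
          Matrix.GeneralLinearGroup.map (scale t) G * M * G⁻¹ ∧
        ∀ i, rowOperator (scale t) (M : Matrix (Fin r) (Fin r) (LaurentSeries ℂ)) (e i) =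
          ∑ j, (HahnSeries.C ((M₀ : Matrix (Fin r) (Fin r) ℂ) i j) : LaurentSeries ℂ) • e j := by
    let X := Matrix.GeneralLinearGroup.map (scale t) G * M * G⁻¹
    have hXG : X * G = Matrix.GeneralLinearGroup.map (scale t) G * M := by
      simp only [X]
      group
    have hX (i : Fin r) :
        rowOperator (scale t) (M : Matrix (Fin r) (Fin r) (LaurentSeries ℂ)) (e i) =
          ∑ j, (X : Matrix (Fin r) (Fin r) (LaurentSeries ℂ)) i j • e j := by
      have h1 := congrArg Units.val hXG
      have h2 : rowOperator (scale t) (M : Matrix (Fin r) (Fin r) (LaurentSeries ℂ)) (D i) =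
          (X.val * D) i := by
        rw [rowOperator_row, ← hG]
        exact (congrFun h1 i).symm
      change rowOperator (scale t) (M : Matrix (Fin r) (Fin r) (LaurentSeries ℂ)) (D i) = _
      rw [h2]
      ext k
      simp [Matrix.mul_apply, D]
    have h3 := (hΦ.pow_scale s).matrix_comm (rowOperator_isTwistedLinear (scale t) M.val)
      (end_pow_comm hMΦ s) e (M := S.map HahnSeries.C) (fun i => he i) hX
    have h4 : (S.map (HahnSeries.C : ℂ →+* LaurentSeries ℂ)).map (scale t) =
        S.map HahnSeries.C :=
      Matrix.ext fun i j => scale_C t _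
    rw [h4] at h3
    have h5 := eq_map_C_of_intertwines (one_lt_norm_pow hp hs) hS hS h3
    obtain ⟨M₀, hM₀, hM₀'⟩ := exists_GL_of_constant h5
    refine ⟨M₀, hM₀', fun i => ?_⟩
    rw [hX, h5, hM₀]
    rfl
  obtain ⟨A₀, hA₀, hA₀e⟩ := hconst p x.A fun v => rfl
  obtain ⟨B₀, hB₀, -⟩ := hconst q x.B hcomm
  have hcons : Matrix.GeneralLinearGroup.map (RingHom.id ℂ) B₀ * A₀ =
      Matrix.GeneralLinearGroup.map (RingHom.id ℂ) A₀ * B₀ := by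
    apply mapGL_C_injective
    have e1 : Matrix.GeneralLinearGroup.map (RingHom.id ℂ) A₀ = A₀ := by
      ext i j : 2
      rfl
    have e2 : Matrix.GeneralLinearGroup.map (RingHom.id ℂ) B₀ = B₀ := by
      ext i j : 2
      rfl
    rw [e1, e2, map_mul, map_mul]
    -- Scaling the constants changes nothing but exhibits the claim as the consistency of a gauge
    -- transform of x.
    nth_rewrite 1 [← mapGL_scale_mapGL_C p B₀]
    nth_rewrite 2 [← mapGL_scale_mapGL_C q A₀]
    rw [hA₀, hB₀]
    simp only [map_mul, map_inv]
    have h1 := x.consistent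
    rw [mapGL_scale_comm q p G]
    have h2 : Matrix.GeneralLinearGroup.map (scale p) x.B =
        Matrix.GeneralLinearGroup.map (scale q) x.A * x.B * x.A⁻¹ := by
      rw [← h1]
      group
    rw [h2]
    group
  have hrest : IsRestricted p A₀ := by
    rw [isRestricted_iff]
    refine SpectrumRestricted.of_pow hs ?_
    -- Both S and A₀^s are the matrix of Φ^s in the basis e.
    have h1 : (S.map HahnSeries.C : Matrix (Fin r) (Fin r) (LaurentSeries ℂ)) =
        ((A₀ : Matrix (Fin r) (Fin r) ℂ) ^ s).map HahnSeries.C :=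
      matrix_eq_of_sum_smul_eq e fun i =>
        (he i).symm.trans (end_pow_basis_constant hΦ hA₀e s i)
    have h2 : S = (A₀ : Matrix (Fin r) (Fin r) ℂ) ^ s := by
      ext i j
      exact HahnSeries.C_injective (congrFun (congrFun h1 i) j)
    rw [← h2]
    exact hS
  refine ⟨⟨A₀, B₀, hcons⟩, hrest, G⁻¹, ?_, ?_⟩
  · rw [map_inv, inv_inv]
    exact hA₀
  · rw [map_inv, inv_inv]
    exact hB₀

theorem mainTheorem6 (r : ℕ) (p q : ℂˣ) (hp : 1 < ‖(p : ℂ)‖) (hq : 1 < ‖(q : ℂ)‖)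
    (hpq : MultIndep p q) :
    Set.BijOn (naturalMap r p q) (H1Restricted r p) Set.univ ∧
      ∀ x : FormalPair r p q,
        (∃ x₀ : ScalarPair r, IsRestricted p x₀.A ∧
          ∃ C : GL (Fin r) (LaurentSeries ℂ), x.GaugeBy C (x₀.toFormal p q)) ∧
        ∀ x₀ x₁ : ScalarPair r,
          IsRestricted p x₀.A → IsRestricted p x₁.A →
          (∃ C : GL (Fin r) (LaurentSeries ℂ), x.GaugeBy C (x₀.toFormal p q)) →
          (∃ C : GL (Fin r) (LaurentSeries ℂ), x.GaugeBy C (x₁.toFormal p q)) →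
          ∃ D : GL (Fin r) ℂ, x₁.A = D⁻¹ * x₀.A * D ∧ x₁.B = D⁻¹ * x₀.B * D := by
  refine ⟨⟨fun _ _ => Set.mem_univ _, ?_, ?_⟩, fun x =>
    ⟨FormalPair.exists_gaugeBy_toFormal hp hpq x, ?_⟩⟩
  · rintro _ ⟨x₀, h₀, rfl⟩ _ ⟨x₁, h₁, rfl⟩ h
    obtain ⟨C, hC⟩ : ∃ C, (x₀.toFormal p q).GaugeBy C (x₁.toFormal p q) :=
      Quotient.exact (s := gaugeSetoid r (scale p) (scale q)) h
    obtain ⟨D, hD⟩ := exists_conj_of_gaugeBy hp h₀ h₁ hC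
    exact Quotient.sound (s := gaugeSetoid r (RingHom.id ℂ) (RingHom.id ℂ)) ⟨D, hD⟩
  · intro c _
    obtain ⟨x, rfl⟩ := Quotient.exists_rep (s := gaugeSetoid r (scale p) (scale q)) c
    obtain ⟨x₀, h₀, C, hC⟩ := FormalPair.exists_gaugeBy_toFormal hp hpq x
    refine ⟨_, ⟨x₀, h₀, rfl⟩, ?_⟩
    exact (Quotient.sound (s := gaugeSetoid r (scale p) (scale q)) ⟨C, hC⟩).symm
  · intro x₀ x₁ h₀ h₁ hx₀ hx₁
    obtain ⟨C, hC⟩ := (gaugeSetoid r (scale p) (scale q)).trans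
      ((gaugeSetoid r (scale p) (scale q)).symm hx₀) hx₁
    exact exists_conj_of_gaugeBy hp h₀ h₁ hC
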